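/- **Setting.** There are $U$ users and $T$ tasks. User $u$ has an unknown vector $\theta^u\in\mathbb R^n$ and task $t$ an unknown matrix $B_t\in\mathbb R^{b\times n}$, with $\|B_t\theta^u\|_2\le 1$ for all $u,t$. In each round $h=1,\dots,H$ the agent observes a context $(u_h,t_h)\in[U]\times[T]$ and a finite nonempty decision set $\mathcal A_h\subset\mathbb R^b$ whose elements have Euclidean norm at most $1$, pulls an arm $x_h\in\mathcal A_h$, and receives the reward $X_h=\langle x_h,B_{t_h}\theta^{u_h}\rangle+\eta_h$. Contexts and decision sets may be random and may depend on the past; the noise $\eta_h$ is $1$-subgaussian with mean $0$ (that is, $\mathbb E\,e^{s\eta_h}\le e^{s^2/2}$ for all $s \in \mathbb R$) and independent of everything up to and including the choice of $x_h$. The regret is $$R_H=\mathbb E\Big[\sum_{t\in[T]}\sum_{u\in[U]}\ \sum_{h:(u_h,t_h)=(u,t)}\ \max_{x\in\mathcal A_h}\langle x,B_t\theta^u\rangle-\sum_{h=1}^H X_h\Big].$$ **Agent.** Fix a regularization parameter $\lambda>0$ and an exponent $q>1$. The agent runs a separate copy of LinUCB for each user–task pair. If round $h$ is the $k$-th round with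 its context, let $S$ be the set of the $k-1$ earlier rounds with that context and put $$V=\lambda I+\sum_{s\in S}x_sx_s^\top,\qquad \hat\theta=V^{-1}\sum_{s\in S}X_sx_s,\qquad \delta_k=k^{-q},$$ $$\rho=\sqrt\lambda+\sqrt{2\log(1/\delta_k)+\log\big(\det V/\lambda^b\big)}.$$ The agent pulls an arm $x_h\in\mathcal A_h$ that maximizes $\langle\hat\theta,x\rangle+\rho\,\sqrt{x^\top V^{-1}x}$ over $x\in\mathcal A_h$; ties are broken arbitrarily, without knowledge of present or future noise. (The agent does not need to know the horizon.) **Theorem (LinUCB bound).** For all $\lambda>0$ and $q>1$ there is a constant $C$, depending only on $\lambda$ and $q$, such that for all $U,T,n,b,H$ and every instance of the above setting the regret is well defined (the random variable inside the expectation is integrable) and $$R_H\le C\,b\,\sqrt{HTU}\;\max\Big\{1,\log\frac{H}{TU}\Big\}.$$ In particular $R_H\le C\,b\sqrt{HTU}\,\log\frac{H}{TU}$ whenever $H\ge e\,TU$. -/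

import Mathlib

open MeasureTheory ProbabilityTheory

noncomputable section

/-- The reward parameter `B_t θ^u` of task `t` for user `u`, where `B t` is the task matrix and
`θ u` the vector of personal data of the user. -/
def rewardParam {U T n b : ℕ} (B : Fin T → Matrix (Fin b) (Fin n) ℝ)
    (θ : Fin U → EuclideanSpace ℝ (Fin n)) (u : Fin U) (t : Fin T) : EuclideanSpace ℝ (Fin b) :=
  WithLp.toLp 2 ((B t).mulVec (θ u).ofLp)

/-- The reward `⟨x, B_t θ^u⟩ + η` of arm `x` in the context `c = (u, t)` with noise `η`. -/
def reward {U T n b : ℕ} (B : Fin T → Matrix (Fin b) (Fin n) ℝ)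
    (θ : Fin U → EuclideanSpace ℝ (Fin n)) (c : Fin U × Fin T) (x : EuclideanSpace ℝ (Fin b))
    (η : ℝ) : ℝ :=
  inner ℝ x (rewardParam B θ c.1 c.2) + η

/-- The regret along one realization: contexts `c h`, decision sets `A h` and collected
rewards `X h` in the rounds `h = 0, …, H - 1`. The supremum is a maximum, as the decision sets are
finite and nonempty. -/
def pathRegret {U T n b : ℕ} (B : Fin T → Matrix (Fin b) (Fin n) ℝ)
    (θ : Fin U → EuclideanSpace ℝ (Fin n)) (H : ℕ) (c : ℕ → Fin U × Fin T)
    (A : ℕ → Finset (EuclideanSpace ℝ (Fin b))) (X : ℕ → ℝ) : ℝ :=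
  (∑ t : Fin T, ∑ u : Fin U, ∑ h ∈ (Finset.range H).filter (fun h => c h = (u, t)),
      ⨆ y : A h, inner ℝ (y : EuclideanSpace ℝ (Fin b)) (rewardParam B θ u t))
    - ∑ h ∈ Finset.range H, X h

section LinUCB

variable {b : ℕ}

/-- Regularized Gram matrix `λ I + ∑_{s ∈ S} x_s x_sᵀ` of the arms pulled in the rounds `S`. -/
def gram (lam : ℝ) (S : Finset ℕ) (x : ℕ → EuclideanSpace ℝ (Fin b)) :
    Matrix (Fin b) (Fin b) ℝ :=
  lam • (1 : Matrix (Fin b) (Fin b) ℝ) + ∑ s ∈ S, Matrix.vecMulVec (x s).ofLp (x s).ofLp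

/-- Ridge regression estimate `V⁻¹ ∑_{s ∈ S} X_s x_s` of the reward parameter from the arms `x s`
and rewards `X s` of the rounds `S`. -/
def ridge (lam : ℝ) (S : Finset ℕ) (x : ℕ → EuclideanSpace ℝ (Fin b)) (X : ℕ → ℝ) :
    Fin b → ℝ :=
  (gram lam S x)⁻¹.mulVec (∑ s ∈ S, X s • (x s).ofLp)

/-- Radius of the confidence ellipsoid at confidence level `1 - δ`, for parameters of norm at
most `1`: `√λ + √(2 log (1/δ) + log (det V / λ^b))`. -/
def confRadius (lam δ : ℝ) (S : Finset ℕ) (x : ℕ → EuclideanSpace ℝ (Fin b)) : ℝ :=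
  √lam + √(2 * Real.log (1 / δ) + Real.log ((gram lam S x).det / lam ^ b))

/-- Upper confidence bound of the arm `y`, that is `⟨ϑ, y⟩` maximized over the confidence ellipsoid
around the ridge estimate: `⟨estimate, y⟩ + radius * √(yᵀ V⁻¹ y)`. -/
def ucb (lam δ : ℝ) (S : Finset ℕ) (x : ℕ → EuclideanSpace ℝ (Fin b)) (X : ℕ → ℝ)
    (y : EuclideanSpace ℝ (Fin b)) : ℝ :=
  dotProduct (ridge lam S x X) y.ofLp
    + confRadius lam δ S x * √(dotProduct y.ofLp ((gram lam S x)⁻¹.mulVec y.ofLp))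

/-- The rounds before round `h` that had the same context as round `h`. -/
def sameContext {P : Type*} [DecidableEq P] (c : ℕ → P) (h : ℕ) : Finset ℕ :=
  (Finset.range h).filter (fun s => c s = c h)

/-- In the rounds `0, …, H - 1` the arms `x h ∈ A h` are those of an agent that runs a separate
copy of LinUCB for every context: in each round it pulls an arm of the decision set with maximal
upper confidence bound, computed only from the earlier rounds with the same context. In its `k`-th
round (`k = 1, 2, …`) each copy uses the confidence level `1 - δ k`. Ties are broken arbitrarily. -/
def IsSeparateLinUCB {P : Type*} [DecidableEq P] (lam : ℝ) (δ : ℕ → ℝ) (H : ℕ) (c : ℕ → P)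
    (A : ℕ → Finset (EuclideanSpace ℝ (Fin b))) (x : ℕ → EuclideanSpace ℝ (Fin b))
    (X : ℕ → ℝ) : Prop :=
  ∀ h < H, x h ∈ A h ∧ ∀ y ∈ A h,
    ucb lam (δ ((sameContext c h).card + 1)) (sameContext c h) x X y
      ≤ ucb lam (δ ((sameContext c h).card + 1)) (sameContext c h) x X (x h)

end LinUCB

end

/-! Each context `p` is a linear bandit of its own, so the regret is bounded copy by copy and then
summed.

Confidence. Write `N = ∑ e_s x_s` for the noise seen by a copy. The process `(λ^b / det V)^(1/2)
exp(‖N‖²_{V⁻¹} / 2)` has mean at most 1 (`lintegral_exp_logMixture_le`): a new round multiplies it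
by a Gaussian mixture of the factors `exp(z η - z²/2)`, each of mean at most 1. By Markov's
inequality the ellipsoid misses the parameter in the `k`-th round of a copy with probability at most
`k^(-q)`. The rounds of a copy occur at random times; instead of stopping times, all arms outside
its first `j` rounds are replaced by zero (`firstArms`). They stay predictable, so the bound at the
fixed horizon `H` applies.

Regret of a copy. While the ellipsoid is valid, optimism bounds the gap by `2ρ‖x‖_{V⁻¹}`. The
elliptical potential lemma and Cauchy–Schwarz then give order `b √n log(e + n)` over `n` rounds
(`sum_gap_le`). Failed rounds cost at most 2 each, hence at most `2 ∑ k^(-q)` per copy in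
expectation.

Summation. As `√n log(e + n)` is essentially concave, the worst split of the `H` rounds is the even
one (`sum_sqrt_mul_log_le`). The failures cost a multiple of `TU ≤ √(HTU)` if `TU ≤ H`; if `H < TU`,
the trivial bound `2H` suffices. -/

/-! ### Rank-one updates of positive definite matrices. -/

section RankOne

open Matrix

variable {ι : Type*} [Fintype ι] {V : Matrix ι ι ℝ}

theorem Matrix.PosDef.add_vecMulVec_self (hV : V.PosDef) (v : ι → ℝ) :
    (V + vecMulVec v v).PosDef := by
  have h := posSemidef_vecMulVec_self_star v
  rw [star_trivial] at h
  exact hV.add_posSemidef h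

theorem Matrix.PosDef.dotProduct_mulVec_comm (hV : V.PosDef) (v w : ι → ℝ) :
    v ⬝ᵥ V *ᵥ w = w ⬝ᵥ V *ᵥ v := by
  have h : Vᵀ = V := by simpa using hV.isHermitian.eq
  rw [dotProduct_mulVec, ← mulVec_transpose, h, dotProduct_comm]

theorem Matrix.PosDef.quad_nonneg (hV : V.PosDef) (v : ι → ℝ) : 0 ≤ v ⬝ᵥ V *ᵥ v := by
  simpa using hV.posSemidef.dotProduct_mulVec_nonneg v

/-- Cauchy–Schwarz inequality for a positive definite matrix. -/
theorem Matrix.PosDef.sq_dotProduct_mulVec_le (hV : V.PosDef) (v w : ι → ℝ) :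
    (v ⬝ᵥ V *ᵥ w) ^ 2 ≤ (v ⬝ᵥ V *ᵥ v) * (w ⬝ᵥ V *ᵥ w) := by
  have h : ∀ r : ℝ, 0 ≤ (w ⬝ᵥ V *ᵥ w) * (r * r) + (2 * (v ⬝ᵥ V *ᵥ w)) * r + v ⬝ᵥ V *ᵥ v := by
    intro r
    have := hV.quad_nonneg (v + r • w)
    simp only [mulVec_add, mulVec_smul, dotProduct_add, add_dotProduct, smul_dotProduct,
      dotProduct_smul, smul_eq_mul, hV.dotProduct_mulVec_comm w v] at this
    linarith
  have := discrim_le_zero h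
  rw [discrim] at this
  linarith

theorem Matrix.PosDef.abs_dotProduct_mulVec_le (hV : V.PosDef) (v w : ι → ℝ) :
    |v ⬝ᵥ V *ᵥ w| ≤ √(v ⬝ᵥ V *ᵥ v) * √(w ⬝ᵥ V *ᵥ w) := by
  rw [← Real.sqrt_mul (hV.quad_nonneg v)]
  exact Real.abs_le_sqrt (hV.sq_dotProduct_mulVec_le v w)

variable [DecidableEq ι]

theorem Matrix.PosDef.mul_inv_mulVec (hV : V.PosDef) (v : ι → ℝ) : V *ᵥ (V⁻¹ *ᵥ v) = v := by
  rw [mulVec_mulVec, mul_nonsing_inv _ hV.det_pos.ne'.isUnit, one_mulVec]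

theorem Matrix.PosDef.inv_mulVec_eq (hV : V.PosDef) {v w : ι → ℝ} (h : V *ᵥ w = v) :
    V⁻¹ *ᵥ v = w := by
  rw [← h, mulVec_mulVec, nonsing_inv_mul _ hV.det_pos.ne'.isUnit, one_mulVec]

/-- Matrix determinant lemma for a symmetric rank-one update. -/
theorem Matrix.PosDef.det_add_vecMulVec_self (hV : V.PosDef) (v : ι → ℝ) :
    (V + vecMulVec v v).det = V.det * (1 + v ⬝ᵥ V⁻¹ *ᵥ v) := by
  have h := det_add_replicateCol_mul_replicateRow (ι := Unit) hV.det_pos.ne'.isUnit v v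
  rw [vecMulVec_eq Unit, h, dotProduct_mulVec]
  congr 2
  rw [← replicateRow_vecMul, det_unique]
  simp [Matrix.mul_apply, dotProduct]

/-- Sherman–Morrison formula for the quadratic form of the inverse. -/
theorem Matrix.PosDef.quad_inv_add_vecMulVec_self (hV : V.PosDef) (v s : ι → ℝ) (e : ℝ) :
    (s + e • v) ⬝ᵥ (V + vecMulVec v v)⁻¹ *ᵥ (s + e • v) = s ⬝ᵥ V⁻¹ *ᵥ s +
      (e ^ 2 * (v ⬝ᵥ V⁻¹ *ᵥ v) + 2 * e * (v ⬝ᵥ V⁻¹ *ᵥ s) - (v ⬝ᵥ V⁻¹ *ᵥ s) ^ 2) /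
        (1 + v ⬝ᵥ V⁻¹ *ᵥ v) := by
  have ha : 0 < 1 + v ⬝ᵥ V⁻¹ *ᵥ v := by linarith [hV.inv.quad_nonneg v]
  -- Explicit solution of the updated linear system, checked by applying `V + v vᵀ` to it.
  have hz : (V + vecMulVec v v)⁻¹ *ᵥ (s + e • v) =
      V⁻¹ *ᵥ s + ((e - v ⬝ᵥ V⁻¹ *ᵥ s) / (1 + v ⬝ᵥ V⁻¹ *ᵥ v)) • V⁻¹ *ᵥ v := by
    apply (hV.add_vecMulVec_self v).inv_mulVec_eq
    rw [add_mulVec, mulVec_add, mulVec_smul, hV.mul_inv_mulVec, hV.mul_inv_mulVec, add_assoc]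
    congr 1
    ext i
    simp only [vecMulVec_mulVec, dotProduct_add, dotProduct_smul, Pi.add_apply, Pi.smul_apply,
      smul_eq_mul, MulOpposite.smul_eq_mul_unop, MulOpposite.unop_op]
    field_simp
    ring
  rw [hz]
  simp only [add_dotProduct, dotProduct_add, smul_dotProduct, dotProduct_smul, smul_eq_mul,
    hV.inv.dotProduct_mulVec_comm s v]
  field_simp
  ring

end RankOne

/-! ### Gram matrices: log-determinant and elliptical potential. -/

section Gram

open Matrix hiding gram

variable {b : ℕ} {lam : ℝ} {x : ℕ → EuclideanSpace ℝ (Fin b)}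

theorem posDef_gram (hlam : 0 < lam) (S : Finset ℕ) (x : ℕ → EuclideanSpace ℝ (Fin b)) :
    (gram lam S x).PosDef := by
  refine (PosDef.one.smul hlam).add_posSemidef (posSemidef_sum _ fun s _ => ?_)
  simpa using posSemidef_vecMulVec_self_star (x s).ofLp

theorem gram_insert {S : Finset ℕ} {s : ℕ} (hs : s ∉ S) :
    gram lam (insert s S) x = gram lam S x + vecMulVec (x s).ofLp (x s).ofLp := by
  rw [gram, gram, Finset.sum_insert hs]
  abel

theorem gram_mulVec (S : Finset ℕ) (v : Fin b → ℝ) :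
    gram lam S x *ᵥ v = lam • v + ∑ s ∈ S, ((x s).ofLp ⬝ᵥ v) • (x s).ofLp := by
  rw [gram, add_mulVec, smul_mulVec, one_mulVec, sum_mulVec]
  congr 1
  refine Finset.sum_congr rfl fun s _ => ?_
  rw [vecMulVec_mulVec, op_smul_eq_smul]

theorem le_quad_gram (S : Finset ℕ) (v : Fin b → ℝ) :
    lam * (v ⬝ᵥ v) ≤ v ⬝ᵥ gram lam S x *ᵥ v := by
  rw [gram_mulVec, dotProduct_add, dotProduct_smul, smul_eq_mul, dotProduct_sum]
  refine le_add_of_nonneg_right (Finset.sum_nonneg fun s _ => ?_)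
  rw [dotProduct_smul, smul_eq_mul, dotProduct_comm v]
  exact mul_self_nonneg _

theorem dotProduct_self_eq_norm_sq (v : EuclideanSpace ℝ (Fin b)) :
    v.ofLp ⬝ᵥ v.ofLp = ‖v‖ ^ 2 := by
  rw [EuclideanSpace.real_norm_sq_eq]
  simp [dotProduct, pow_two]

theorem inner_eq_dotProduct (v w : EuclideanSpace ℝ (Fin b)) :
    inner ℝ v w = v.ofLp ⬝ᵥ w.ofLp := by
  simp [PiLp.inner_apply, dotProduct, mul_comm]

/-- Bound of the log-determinant of the Gram matrix of arms of norm at most `1`. -/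
theorem log_det_gram_le (hlam : 0 < lam) (S : Finset ℕ) (hx : ∀ s ∈ S, ‖x s‖ ≤ 1) :
    Real.log ((gram lam S x).det / lam ^ b) ≤ b * Real.log (1 + S.card / lam) := by
  rcases Nat.eq_zero_or_pos b with rfl | hb
  · simp
  have hV := posDef_gram hlam S x
  -- A crude bound for the mean eigenvalue: each arm adds at most 1 to the trace. Below, `log t ≤ t
  -- - 1` at `t = eigenvalue / μ` plays the role of the AM–GM inequality.
  set μ : ℝ := lam + S.card with hμ
  have hμ0 : 0 < μ := by positivity
  have htr : (gram lam S x).trace ≤ b * μ := by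
    rw [gram, trace_add, trace_smul, trace_one, trace_sum]
    have h1 : ∑ s ∈ S, (vecMulVec (x s).ofLp (x s).ofLp).trace ≤ S.card := by
      have : ∀ s ∈ S, (vecMulVec (x s).ofLp (x s).ofLp).trace ≤ 1 := fun s hs => by
        rw [trace_vecMulVec, dotProduct_self_eq_norm_sq]
        exact pow_le_one₀ (norm_nonneg _) (hx s hs)
      simpa using Finset.sum_le_sum this
    have h2 : (S.card : ℝ) ≤ b * S.card :=
      le_mul_of_one_le_left (by positivity) (by exact_mod_cast hb)
    simp only [Fintype.card_fin, smul_eq_mul]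
    rw [hμ]
    linarith
  rw [hV.isHermitian.trace_eq_sum_eigenvalues] at htr
  have hpos := hV.eigenvalues_pos
  have hdet : Real.log (gram lam S x).det ≤ b * Real.log μ := by
    rw [hV.isHermitian.det_eq_prod_eigenvalues]
    simp only [RCLike.ofReal_real_eq_id, id] at htr ⊢
    rw [Real.log_prod (fun i _ => (hpos i).ne')]
    have h1 : ∀ i ∈ Finset.univ, Real.log (hV.isHermitian.eigenvalues i) ≤
        Real.log μ + (hV.isHermitian.eigenvalues i / μ - 1) := fun i _ => by
      have := Real.log_le_sub_one_of_pos (div_pos (hpos i) hμ0)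
      rw [Real.log_div (hpos i).ne' hμ0.ne'] at this
      linarith
    refine (Finset.sum_le_sum h1).trans ?_
    rw [Finset.sum_add_distrib, Finset.sum_sub_distrib, ← Finset.sum_div]
    have := (div_le_iff₀ hμ0).2 htr
    simp only [Finset.sum_const, Finset.card_univ, Fintype.card_fin, nsmul_eq_mul, mul_one]
    linarith
  have h3 : 1 + (S.card : ℝ) / lam = μ / lam := by rw [hμ]; field_simp
  rw [Real.log_div hV.det_pos.ne' (by positivity), Real.log_pow, h3,
    Real.log_div hμ0.ne' hlam.ne']
  linarith

/-- Both `log (1 + u) ≥ u / (1 + u)` and `u / (1 + u) ≥ min 1 u / 2`; the truncation at 1 is what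
makes a linear bound by the logarithm possible. -/
theorem min_one_le_two_mul_log {u : ℝ} (hu : 0 ≤ u) : min 1 u ≤ 2 * Real.log (1 + u) := by
  have h := Real.one_sub_inv_le_log_of_pos (by linarith : 0 < 1 + u)
  have h2 : min 1 u ≤ 2 * (1 - (1 + u)⁻¹) := by
    have h3 : 1 - (1 + u)⁻¹ = u / (1 + u) := by field_simp; ring
    rw [h3, ← mul_div_assoc, le_div_iff₀ (by linarith)]
    rcases le_total 1 u with h1 | h1
    · rw [min_eq_left h1]; linarith
    · rw [min_eq_right h1]; nlinarith
  linarith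

/-- Elliptical potential lemma, along the rounds that satisfy a predicate. -/
theorem sum_min_one_quad_inv_gram_le (hlam : 0 < lam) (P : ℕ → Prop) [DecidablePred P] (H : ℕ) :
    ∑ h ∈ (Finset.range H).filter P,
        min 1 ((x h).ofLp ⬝ᵥ (gram lam ((Finset.range h).filter P) x)⁻¹ *ᵥ (x h).ofLp) ≤
      2 * Real.log ((gram lam ((Finset.range H).filter P) x).det / lam ^ b) := by
  induction H with
  | zero => simp [gram, div_self (pow_pos hlam b).ne']
  | succ H ih =>
    rw [Finset.range_add_one, Finset.filter_insert]
    split_ifs with hP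
    · have hn : H ∉ (Finset.range H).filter P := by simp
      have hV := posDef_gram hlam ((Finset.range H).filter P) x
      have hq := hV.inv.quad_nonneg (x H).ofLp
      -- The new arm multiplies the determinant by one plus its quadratic form, so the logarithms
      -- telescope.
      rw [Finset.sum_insert hn, gram_insert hn, hV.det_add_vecMulVec_self, mul_div_right_comm,
        Real.log_mul (div_pos hV.det_pos (pow_pos hlam b)).ne' (by linarith), mul_add, add_comm]
      exact add_le_add ih (min_one_le_two_mul_log hq)
    · exact ih

end Gram

/-! ### One step of the self-normalized supermartingale. -/

section SelfNormalized

/-- Gaussian mixture over the parameter of the exponential supermartingale, in dimension one. -/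
theorem lintegral_exp_mixture_le {ν : Measure ℝ} [SFinite ν]
    (hν : ∀ z : ℝ, ∫⁻ e, ENNReal.ofReal (Real.exp (z * e - z ^ 2 / 2)) ∂ν ≤ 1)
    {a : ℝ} (ha : 0 ≤ a) (r : ℝ) :
    ∫⁻ e, ENNReal.ofReal (Real.exp
      (((e ^ 2 * a + 2 * e * r - r ^ 2) / (1 + a) - Real.log (1 + a)) / 2)) ∂ν ≤ 1 := by
  -- For `a = 0` the mixing Gaussian degenerates to the point mass at `r`.
  rcases ha.eq_or_lt with rfl | ha
  · refine le_trans (le_of_eq ?_) (hν r)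
    refine lintegral_congr fun e => ?_
    congr 2
    simp
    ring
  have h1a : 0 < 1 + a := by linarith
  obtain ⟨v, hv⟩ : ∃ v : NNReal, (v : ℝ) = a := ⟨⟨a, ha.le⟩, rfl⟩
  obtain ⟨v', hv'⟩ : ∃ v' : NNReal, (v' : ℝ) = a / (1 + a) := ⟨⟨_, (div_pos ha h1a).le⟩, rfl⟩
  have hv0 : v ≠ 0 := fun h => ha.ne' (by rw [← hv, h, NNReal.coe_zero])
  have hv'0 : v' ≠ 0 := fun h => (div_pos ha h1a).ne' (by rw [← hv', h, NNReal.coe_zero])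
  have hroot : (√(2 * Real.pi * a))⁻¹ =
      Real.exp (-Real.log (1 + a) / 2) * (√(2 * Real.pi * (a / (1 + a))))⁻¹ := by
    have h1 : Real.exp (-Real.log (1 + a) / 2) = (√(1 + a))⁻¹ := by
      rw [neg_div, Real.exp_neg, Real.exp_half, Real.exp_log h1a]
    rw [h1, ← mul_inv, ← Real.sqrt_mul h1a.le]
    congr 2
    field_simp
  -- Completing the square in `z`: the tilted `N(r, a)` density is a multiple of the density of mean
  -- `(a e + r) / (1 + a)` and variance `a / (1 + a)`. The multiple is the integrand of the claim;
  -- its logarithm term is the ratio of the normalizing constants.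
  have hsq : ∀ e z : ℝ, Real.exp (z * e - z ^ 2 / 2) * gaussianPDFReal r v z =
      Real.exp (((e ^ 2 * a + 2 * e * r - r ^ 2) / (1 + a) - Real.log (1 + a)) / 2) *
        gaussianPDFReal ((a * e + r) / (1 + a)) v' z := by
    intro e z
    simp only [gaussianPDFReal, hv, hv']
    rw [hroot]
    have h2 : z * e - z ^ 2 / 2 + -(z - r) ^ 2 / (2 * a) =
        (e ^ 2 * a + 2 * e * r - r ^ 2) / (1 + a) / 2 +
          -(z - (a * e + r) / (1 + a)) ^ 2 / (2 * (a / (1 + a))) := by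
      field_simp
      ring
    calc _ = Real.exp (-Real.log (1 + a) / 2) * (√(2 * Real.pi * (a / (1 + a))))⁻¹ *
          Real.exp (z * e - z ^ 2 / 2 + -(z - r) ^ 2 / (2 * a)) := by rw [Real.exp_add]; ring
      _ = _ := by
        rw [h2, sub_div _ (Real.log _), sub_eq_add_neg _ (Real.log _ / 2), ← neg_div,
          Real.exp_add, Real.exp_add]
        ring
  have hmix : ∀ e : ℝ, ENNReal.ofReal (Real.exp
      (((e ^ 2 * a + 2 * e * r - r ^ 2) / (1 + a) - Real.log (1 + a)) / 2)) =
      ∫⁻ z, ENNReal.ofReal (Real.exp (z * e - z ^ 2 / 2)) * gaussianPDF r v z := by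
    intro e
    simp_rw [gaussianPDF, ← ENNReal.ofReal_mul (Real.exp_pos _).le, hsq,
      ENNReal.ofReal_mul (Real.exp_pos _).le]
    rw [lintegral_const_mul _ (measurable_gaussianPDFReal _ _).ennreal_ofReal]
    have := lintegral_gaussianPDF_eq_one ((a * e + r) / (1 + a)) hv'0
    simp only [gaussianPDF] at this
    rw [this, mul_one]
  simp_rw [hmix]
  have hg := measurable_gaussianPDF r v
  rw [lintegral_lintegral_swap (by fun_prop)]
  calc ∫⁻ z, ∫⁻ e, ENNReal.ofReal (Real.exp (z * e - z ^ 2 / 2)) * gaussianPDF r v z ∂ν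
      ≤ ∫⁻ z, gaussianPDF r v z := by
        refine lintegral_mono fun z => ?_
        rw [lintegral_mul_const _ (by fun_prop)]
        exact mul_le_of_le_one_left' (hν z)
    _ = 1 := lintegral_gaussianPDF_eq_one r hv0

variable {Ω : Type*} {m mΩ : MeasurableSpace Ω} {μ : Measure Ω}

theorem lintegral_exp_le_of_hasSubgaussianMGF {η : Ω → ℝ} (hη : HasSubgaussianMGF η 1 μ)
    (z : ℝ) : ∫⁻ ω, ENNReal.ofReal (Real.exp (z * η ω - z ^ 2 / 2)) ∂μ ≤ 1 := by
  have h1 : ∀ ω, Real.exp (z * η ω - z ^ 2 / 2) =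
      Real.exp (-(z ^ 2 / 2)) * Real.exp (z * η ω) := fun ω => by
    rw [← Real.exp_add]; congr 1; ring
  rw [← ofReal_integral_eq_lintegral_ofReal]
  · simp_rw [h1]
    rw [integral_const_mul, ENNReal.ofReal_le_one]
    have h2 := hη.mgf_le z
    rw [mgf] at h2
    calc _ ≤ Real.exp (-(z ^ 2 / 2)) * Real.exp ((1 : NNReal) * z ^ 2 / 2) := by gcongr
      _ = 1 := by rw [← Real.exp_add]; simp
  · simp_rw [h1]
    exact (hη.integrable_exp_mul z).const_mul _
  · exact Filter.Eventually.of_forall fun ω => (Real.exp_pos _).le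

/-- A subgaussian random variable with parameter `1` has mean zero. -/
theorem integral_eq_zero_of_hasSubgaussianMGF [IsProbabilityMeasure μ] {η : Ω → ℝ}
    (hη : HasSubgaussianMGF η 1 μ) : ∫ ω, η ω ∂μ = 0 := by
  -- From `1 + t E η ≤ E exp(t η) ≤ exp(t²/2) ≤ 1 + t²`. Dividing by small `t` of either sign forces
  -- the mean to vanish.
  have h : ∀ t : ℝ, |t| ≤ 1 → t * ∫ ω, η ω ∂μ ≤ t ^ 2 := by
    intro t ht
    have h1 : t * (∫ ω, η ω ∂μ) + 1 ≤ mgf η μ t := by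
      have : ∫ ω, (t * η ω + 1) ∂μ ≤ mgf η μ t :=
        integral_mono ((hη.integrable.const_mul t).add (integrable_const 1))
          (hη.integrable_exp_mul t) fun ω => Real.add_one_le_exp _
      rwa [integral_add (hη.integrable.const_mul t) (integrable_const 1), integral_const_mul,
        integral_const, probReal_univ, one_smul] at this
    have h2 := hη.mgf_le t
    have h3 : t ^ 2 ≤ 1 := (sq_le_one_iff_abs_le_one t).2 ht
    have h4 := Real.abs_exp_sub_one_le (x := t ^ 2 / 2)
      (by rw [abs_of_nonneg (by positivity)]; linarith)
    rw [abs_of_nonneg (a := t ^ 2 / 2) (by positivity)] at h4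
    have h5 := le_abs_self (Real.exp (t ^ 2 / 2) - 1)
    simp only [NNReal.coe_one, one_mul] at h2
    linarith
  refine le_antisymm (le_of_forall_pos_le_add fun ε hε => ?_)
    (le_of_forall_pos_le_add fun ε hε => ?_)
  · have h1 : 0 < min ε 1 := lt_min hε one_pos
    have := h (min ε 1) (by rw [abs_of_pos h1]; exact min_le_right _ _)
    rw [pow_two] at this
    linarith [le_of_mul_le_mul_left this h1, min_le_left ε 1]
  · have h1 : 0 < min ε 1 := lt_min hε one_pos
    have := h (-min ε 1) (by rw [abs_neg, abs_of_pos h1]; exact min_le_right _ _)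
    have h2 : min ε 1 * -(∫ ω, η ω ∂μ) ≤ min ε 1 * min ε 1 := by linarith
    linarith [le_of_mul_le_mul_left h2 h1, min_le_left ε 1]

/-- One step of the self-normalized exponential supermartingale. -/
theorem lintegral_exp_add_mixture_le [IsProbabilityMeasure μ] (hm : m ≤ mΩ) {η : Ω → ℝ}
    (hη : Measurable η) (hind : Indep (MeasurableSpace.comap η inferInstance) m μ)
    (hsub : HasSubgaussianMGF η 1 μ) {l a r : Ω → ℝ} (hl : Measurable[m] l)
    (ha : Measurable[m] a) (hr : Measurable[m] r) (ha0 : ∀ ω, 0 ≤ a ω) :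
    ∫⁻ ω, ENNReal.ofReal (Real.exp (l ω + ((η ω ^ 2 * a ω + 2 * η ω * r ω - r ω ^ 2) /
        (1 + a ω) - Real.log (1 + a ω)) / 2)) ∂μ ≤
      ∫⁻ ω, ENNReal.ofReal (Real.exp (l ω)) ∂μ := by
  -- The past enters only through this triple, which is independent of `η`; by Tonelli it can be
  -- frozen while integrating over the noise.
  let Y : Ω → ℝ × ℝ × ℝ := fun ω => (l ω, a ω, r ω)
  have hYm : Measurable[m] Y := hl.prodMk (ha.prodMk hr)
  have hY : Measurable Y := hYm.mono hm le_rfl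
  have hYη : IndepFun Y η μ :=
    indep_of_indep_of_le_left hind.symm hYm.comap_le
  have hprod := (indepFun_iff_map_prod_eq_prod_map_map hY.aemeasurable hη.aemeasurable).1 hYη
  have := Measure.isProbabilityMeasure_map (μ := μ) hη.aemeasurable
  have := Measure.isProbabilityMeasure_map (μ := μ) hY.aemeasurable
  let F : (ℝ × ℝ × ℝ) × ℝ → ENNReal := fun p => ENNReal.ofReal (Real.exp (p.1.1 +
    ((p.2 ^ 2 * p.1.2.1 + 2 * p.2 * p.1.2.2 - p.1.2.2 ^ 2) /
        (1 + p.1.2.1) - Real.log (1 + p.1.2.1)) / 2))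
  have hF : Measurable F := by
    refine ENNReal.measurable_ofReal.comp (Real.measurable_exp.comp ?_)
    exact measurable_fst.fst.add (((Measurable.div (by fun_prop) (by fun_prop)).sub
      (Real.measurable_log.comp (by fun_prop))).div_const 2)
  calc _ = ∫⁻ ω, F (Y ω, η ω) ∂μ := rfl
    _ = ∫⁻ p, F p ∂(μ.map fun ω => (Y ω, η ω)) := (lintegral_map hF (hY.prodMk hη)).symm
    _ = ∫⁻ y, ∫⁻ e, F (y, e) ∂(μ.map η) ∂(μ.map Y) := by
      rw [hprod, lintegral_prod _ hF.aemeasurable]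
    _ = ∫⁻ ω, ∫⁻ e, F (Y ω, e) ∂(μ.map η) ∂μ := lintegral_map hF.lintegral_prod_right' hY
    _ ≤ _ := by
      refine lintegral_mono fun ω => ?_
      simp only [F, Y, Real.exp_add, ENNReal.ofReal_mul (Real.exp_pos _).le]
      rw [lintegral_const_mul' _ _ ENNReal.ofReal_ne_top]
      refine mul_le_of_le_one_right' (lintegral_exp_mixture_le (fun z => ?_) (ha0 ω) (r ω))
      rw [lintegral_map (by fun_prop) hη]
      exact lintegral_exp_le_of_hasSubgaussianMGF hsub z

end SelfNormalized

/-! ### The self-normalized supermartingale of vector-valued arms. -/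

section Mixture

open Matrix hiding gram

variable {b : ℕ} {lam : ℝ}

/-- Logarithm of the self-normalized exponential supermartingale
`(λ^b / det V)^(1/2) * exp (‖∑ e_s x_s‖²_{V⁻¹} / 2)`. -/
noncomputable def logMixture (lam : ℝ) (S : Finset ℕ) (x : ℕ → EuclideanSpace ℝ (Fin b))
    (e : ℕ → ℝ) : ℝ :=
  ((∑ s ∈ S, e s • (x s).ofLp) ⬝ᵥ (gram lam S x)⁻¹ *ᵥ (∑ s ∈ S, e s • (x s).ofLp)
    - Real.log ((gram lam S x).det / lam ^ b)) / 2

/-- Sherman–Morrison for the quadratic form and the determinant lemma for the logarithm combine to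
the increment of `lintegral_exp_mixture_le`, with `a = ‖x_s‖²_{V⁻¹}` and `r = x_sᵀ V⁻¹ N`. -/
theorem logMixture_insert (hlam : 0 < lam) {S : Finset ℕ} {s : ℕ} (hs : s ∉ S)
    (x : ℕ → EuclideanSpace ℝ (Fin b)) (e : ℕ → ℝ) :
    logMixture lam (insert s S) x e = logMixture lam S x e +
      ((e s ^ 2 * ((x s).ofLp ⬝ᵥ (gram lam S x)⁻¹ *ᵥ (x s).ofLp) +
        2 * e s * ((x s).ofLp ⬝ᵥ (gram lam S x)⁻¹ *ᵥ ∑ s ∈ S, e s • (x s).ofLp) -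
        ((x s).ofLp ⬝ᵥ (gram lam S x)⁻¹ *ᵥ ∑ s ∈ S, e s • (x s).ofLp) ^ 2) /
        (1 + (x s).ofLp ⬝ᵥ (gram lam S x)⁻¹ *ᵥ (x s).ofLp) -
        Real.log (1 + (x s).ofLp ⬝ᵥ (gram lam S x)⁻¹ *ᵥ (x s).ofLp)) / 2 := by
  have hV := posDef_gram hlam S x
  have hq := hV.inv.quad_nonneg (x s).ofLp
  rw [logMixture, logMixture, gram_insert hs, Finset.sum_insert hs, add_comm (e s • _),
    hV.quad_inv_add_vecMulVec_self, hV.det_add_vecMulVec_self, mul_div_right_comm,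
    Real.log_mul (div_pos hV.det_pos (pow_pos hlam b)).ne' (by linarith)]
  ring

variable {Ω : Type*} {m : MeasurableSpace Ω}

theorem measurable_comp_matrix {ι : Type*} [Fintype ι] {V : Ω → Matrix ι ι ℝ}
    (hV : ∀ i j, Measurable fun ω => V ω i j) {f : Matrix ι ι ℝ → ℝ} (hf : Continuous f) :
    Measurable fun ω => f (V ω) :=
  have hf' : Continuous fun M : ι → ι → ℝ => f (Matrix.of M) := hf
  hf'.measurable.comp (measurable_pi_lambda _ fun i => measurable_pi_lambda _ fun j => hV i j)

/-- The inverse is the adjugate divided by the determinant, and both are polynomials in the entries.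
-/
theorem measurable_dotProduct_inv_mulVec {ι : Type*} [Fintype ι] [DecidableEq ι]
    {V : Ω → Matrix ι ι ℝ} {v w : Ω → ι → ℝ} (hV : ∀ i j, Measurable fun ω => V ω i j)
    (hv : Measurable v) (hw : Measurable w) :
    Measurable fun ω => v ω ⬝ᵥ (V ω)⁻¹ *ᵥ w ω := by
  simp only [Matrix.inv_def, Ring.inverse_eq_inv', smul_mulVec, dotProduct_smul, smul_eq_mul]
  refine (measurable_comp_matrix hV (Continuous.matrix_det continuous_id)).inv.mul ?_
  simp only [dotProduct, mulVec]
  refine Finset.measurable_sum _ fun i _ => ((measurable_pi_apply i).comp hv).mul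
    (Finset.measurable_sum _ fun j _ => Measurable.mul ?_ ((measurable_pi_apply j).comp hw))
  exact measurable_comp_matrix hV
    ((Continuous.matrix_adjugate continuous_id).matrix_elem i j)

variable {S : Finset ℕ} {x : ℕ → Ω → EuclideanSpace ℝ (Fin b)} {e : ℕ → Ω → ℝ}

theorem measurable_ofLp_comp {v : Ω → EuclideanSpace ℝ (Fin b)} (hv : Measurable v) :
    Measurable fun ω => (v ω).ofLp :=
  (PiLp.continuous_ofLp 2 _).measurable.comp hv

theorem measurable_gram (hx : ∀ s ∈ S, Measurable (x s)) :
    ∀ i j, Measurable fun ω => gram lam S (fun s => x s ω) i j := by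
  intro i j
  simp only [gram, Matrix.add_apply, Matrix.sum_apply, vecMulVec_apply]
  refine measurable_const.add (Finset.measurable_sum _ fun s hs => ?_)
  have h := measurable_ofLp_comp (hx s hs)
  exact ((measurable_pi_apply i).comp h).mul ((measurable_pi_apply j).comp h)

theorem measurable_sum_smul (hx : ∀ s ∈ S, Measurable (x s)) (he : ∀ s ∈ S, Measurable (e s)) :
    Measurable fun ω => ∑ s ∈ S, e s ω • (x s ω).ofLp :=
  Finset.measurable_sum _ fun s hs => (he s hs).smul (measurable_ofLp_comp (hx s hs))

theorem measurable_logMixture (hx : ∀ s ∈ S, Measurable (x s)) (he : ∀ s ∈ S, Measurable (e s)) :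
    Measurable fun ω => logMixture lam S (fun s => x s ω) (fun s => e s ω) := by
  have hV := measurable_gram (lam := lam) hx
  have hdet : Measurable fun ω => (gram lam S (fun s => x s ω)).det :=
    measurable_comp_matrix hV (Continuous.matrix_det continuous_id)
  exact ((measurable_dotProduct_inv_mulVec hV (measurable_sum_smul hx he)
    (measurable_sum_smul hx he)).sub (Real.measurable_log.comp (hdet.div_const _))).div_const 2

/-- The self-normalized exponential process of predictable arms and independent subgaussian noise
has expectation at most `1`. -/
theorem lintegral_exp_logMixture_le (hlam : 0 < lam) {mΩ : MeasurableSpace Ω} {μ : Measure Ω}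
    [IsProbabilityMeasure μ] {ℱ : Filtration ℕ mΩ} {H : ℕ}
    (hx : ∀ h < H, Measurable[ℱ h] (x h)) (he : ∀ h < H, Measurable[ℱ (h + 1)] (e h))
    (hind : ∀ h < H, Indep (MeasurableSpace.comap (e h) inferInstance) (ℱ h) μ)
    (hsub : ∀ h < H, HasSubgaussianMGF (e h) 1 μ) :
    ∫⁻ ω, ENNReal.ofReal (Real.exp
      (logMixture lam (Finset.range H) (fun s => x s ω) (fun s => e s ω))) ∂μ ≤ 1 := by
  induction H with
  | zero => simp [logMixture, gram]
  | succ H ih =>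
    refine le_trans ?_ (ih (fun h hh => hx h (by omega)) (fun h hh => he h (by omega))
      (fun h hh => hind h (by omega)) (fun h hh => hsub h (by omega)))
    have hx' : ∀ s ∈ Finset.range H, Measurable[ℱ H] (x s) := fun s hs => by
      rw [Finset.mem_range] at hs
      exact (hx s (by omega)).mono (ℱ.mono hs.le) le_rfl
    have he' : ∀ s ∈ Finset.range H, Measurable[ℱ H] (e s) := fun s hs => by
      rw [Finset.mem_range] at hs
      exact (he s (by omega)).mono (ℱ.mono hs) le_rfl
    have hxH := measurable_ofLp_comp (hx H (by omega))
    have hV := measurable_gram (lam := lam) hx'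
    simp_rw [Finset.range_add_one, logMixture_insert hlam Finset.notMem_range_self]
    exact lintegral_exp_add_mixture_le (ℱ.le H) ((he H (by omega)).mono (ℱ.le _) le_rfl)
      (hind H (by omega)) (hsub H (by omega)) (measurable_logMixture hx' he')
      (measurable_dotProduct_inv_mulVec hV hxH hxH)
      (measurable_dotProduct_inv_mulVec hV hxH (measurable_sum_smul hx' he'))
      fun ω => (posDef_gram hlam _ _).inv.quad_nonneg _

end Mixture

/-! ### Confidence ellipsoids and optimism. -/

section Confidence

open Matrix hiding gram

variable {b : ℕ} {lam δ : ℝ} {S : Finset ℕ} {x : ℕ → EuclideanSpace ℝ (Fin b)} {X e : ℕ → ℝ}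
  {ϑ : EuclideanSpace ℝ (Fin b)}

/-- Splits the estimation error into the bias due to regularization and the noise. The noise is
controlled by `logMixture`, the bias by the next lemma. -/
theorem ridge_eq (hlam : 0 < lam) (hX : ∀ s ∈ S, X s = inner ℝ (x s) ϑ + e s) :
    ridge lam S x X = ϑ.ofLp - lam • (gram lam S x)⁻¹ *ᵥ ϑ.ofLp +
      (gram lam S x)⁻¹ *ᵥ ∑ s ∈ S, e s • (x s).ofLp := by
  have hV := posDef_gram hlam S x
  have h1 : ∑ s ∈ S, X s • (x s).ofLp = gram lam S x *ᵥ ϑ.ofLp - lam • ϑ.ofLp +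
      ∑ s ∈ S, e s • (x s).ofLp := by
    rw [gram_mulVec, add_sub_cancel_left, ← Finset.sum_add_distrib]
    refine Finset.sum_congr rfl fun s hs => ?_
    rw [hX s hs, inner_eq_dotProduct, add_smul]
  rw [ridge, h1, mulVec_add, mulVec_sub, mulVec_smul, hV.inv_mulVec_eq rfl]

/-- Source of the summand `√λ` of the radius: `V ≥ λ I` gives `λ ‖V⁻¹ y‖² ≤ yᵀ V⁻¹ y`. -/
theorem mul_abs_dotProduct_inv_gram_le (hlam : 0 < lam) (hϑ : ‖ϑ‖ ≤ 1) (y : Fin b → ℝ) :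
    lam * |y ⬝ᵥ (gram lam S x)⁻¹ *ᵥ ϑ.ofLp| ≤ √lam * √(y ⬝ᵥ (gram lam S x)⁻¹ *ᵥ y) := by
  have hV := posDef_gram hlam S x
  set z := (gram lam S x)⁻¹ *ᵥ y with hz
  have h1 : |ϑ.ofLp ⬝ᵥ z| ≤ √(z ⬝ᵥ z) := by
    have h2 := abs_real_inner_le_norm ϑ (WithLp.toLp 2 z)
    rw [inner_eq_dotProduct] at h2
    have h3 := dotProduct_self_eq_norm_sq (WithLp.toLp 2 z)
    simp only at h2 h3
    rw [h3, Real.sqrt_sq (norm_nonneg _)]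
    exact h2.trans (mul_le_of_le_one_left (norm_nonneg _) hϑ)
  have h4 : lam * (z ⬝ᵥ z) ≤ y ⬝ᵥ z := by
    refine (le_quad_gram (x := x) S z).trans_eq ?_
    rw [hz, hV.mul_inv_mulVec, dotProduct_comm]
  rw [hV.inv.dotProduct_mulVec_comm, ← hz]
  calc lam * |ϑ.ofLp ⬝ᵥ z| ≤ lam * √(z ⬝ᵥ z) := by gcongr
    _ = √lam * √(lam * (z ⬝ᵥ z)) := by
      rw [Real.sqrt_mul hlam.le, ← mul_assoc, Real.mul_self_sqrt hlam.le]
    _ ≤ _ := by gcongr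

/-- On the event that the self-normalized process is at most `1 / δ`, the confidence ellipsoid
contains the reward parameter. -/
theorem abs_ridge_sub_le (hlam : 0 < lam) (hϑ : ‖ϑ‖ ≤ 1)
    (hX : ∀ s ∈ S, X s = inner ℝ (x s) ϑ + e s)
    (hgood : logMixture lam S x e ≤ Real.log (1 / δ)) (y : EuclideanSpace ℝ (Fin b)) :
    |ridge lam S x X ⬝ᵥ y.ofLp - inner ℝ y ϑ| ≤
      confRadius lam δ S x * √(y.ofLp ⬝ᵥ (gram lam S x)⁻¹ *ᵥ y.ofLp) := by
  have hV := posDef_gram hlam S x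
  set N := ∑ s ∈ S, e s • (x s).ofLp with hN
  have h1 : ridge lam S x X ⬝ᵥ y.ofLp - inner ℝ y ϑ =
      y.ofLp ⬝ᵥ (gram lam S x)⁻¹ *ᵥ N - lam * (y.ofLp ⬝ᵥ (gram lam S x)⁻¹ *ᵥ ϑ.ofLp) := by
    rw [dotProduct_comm, ridge_eq hlam hX, inner_eq_dotProduct, dotProduct_add, dotProduct_sub,
      dotProduct_smul, smul_eq_mul]
    ring
  rw [h1, confRadius, add_mul, add_comm (√lam * _)]
  refine (abs_sub _ _).trans (add_le_add ?_ ?_)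
  · refine (hV.inv.abs_dotProduct_mulVec_le _ _).trans ?_
    rw [mul_comm]
    gcongr
    rw [logMixture, ← hN] at hgood
    linarith
  · rw [abs_mul, abs_of_pos hlam]
    exact mul_abs_dotProduct_inv_gram_le hlam hϑ _

/-- Instantaneous regret of an arm of maximal upper confidence bound. -/
theorem iSup_inner_sub_inner_le (hlam : 0 < lam) (hϑ : ‖ϑ‖ ≤ 1)
    (hX : ∀ s ∈ S, X s = inner ℝ (x s) ϑ + e s)
    (hgood : logMixture lam S x e ≤ Real.log (1 / δ)) {A : Finset (EuclideanSpace ℝ (Fin b))}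
    (hA : A.Nonempty) {a : EuclideanSpace ℝ (Fin b)}
    (ha : ∀ y ∈ A, ucb lam δ S x X y ≤ ucb lam δ S x X a) :
    (⨆ y : A, inner ℝ (y : EuclideanSpace ℝ (Fin b)) ϑ) - inner ℝ a ϑ ≤
      2 * (confRadius lam δ S x * √(a.ofLp ⬝ᵥ (gram lam S x)⁻¹ *ᵥ a.ofLp)) := by
  have : Nonempty A := hA.to_subtype
  rw [sub_le_iff_le_add]
  refine ciSup_le fun y => ?_
  -- Optimism: `⟨y, ϑ⟩ ≤ ucb y ≤ ucb a ≤ ⟨a, ϑ⟩ + 2 ρ ‖a‖_{V⁻¹}`.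
  have h1 := (abs_le.1 (abs_ridge_sub_le hlam hϑ hX hgood (y : EuclideanSpace ℝ (Fin b)))).1
  have h2 := (abs_le.1 (abs_ridge_sub_le hlam hϑ hX hgood a)).2
  have h3 := ha y y.2
  rw [ucb, ucb] at h3
  linarith

theorem abs_inner_le_one {y : EuclideanSpace ℝ (Fin b)} (hy : ‖y‖ ≤ 1) (hϑ : ‖ϑ‖ ≤ 1) :
    |inner ℝ y ϑ| ≤ 1 :=
  (abs_real_inner_le_norm y ϑ).trans (mul_le_one₀ hy (norm_nonneg _) hϑ)

theorem iSup_inner_sub_inner_le_two (hϑ : ‖ϑ‖ ≤ 1) {A : Finset (EuclideanSpace ℝ (Fin b))}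
    (hA : A.Nonempty) (hA1 : ∀ y ∈ A, ‖y‖ ≤ 1) {a : EuclideanSpace ℝ (Fin b)} (ha : ‖a‖ ≤ 1) :
    (⨆ y : A, inner ℝ (y : EuclideanSpace ℝ (Fin b)) ϑ) - inner ℝ a ϑ ≤ 2 := by
  have : Nonempty A := hA.to_subtype
  rw [sub_le_iff_le_add]
  refine ciSup_le fun y => ?_
  have h1 := (abs_le.1 (abs_inner_le_one (hA1 y y.2) hϑ)).2
  have h2 := (abs_le.1 (abs_inner_le_one ha hϑ)).1
  linarith

theorem iSup_inner_sub_inner_nonneg {A : Finset (EuclideanSpace ℝ (Fin b))}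
    {a : EuclideanSpace ℝ (Fin b)} (ha : a ∈ A) :
    0 ≤ (⨆ y : A, inner ℝ (y : EuclideanSpace ℝ (Fin b)) ϑ) - inner ℝ a ϑ :=
  sub_nonneg.2 (le_ciSup (f := fun y : A => inner ℝ (y : EuclideanSpace ℝ (Fin b)) ϑ)
    (Set.finite_range _).bddAbove ⟨a, ha⟩)

theorem confRadius_le_of_log_le {R : ℝ}
    (hR : 2 * Real.log (1 / δ) + Real.log ((gram lam S x).det / lam ^ b) ≤ R) :
    confRadius lam δ S x ≤ √lam + √R := by
  rw [confRadius]
  gcongr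

end Confidence

/-! ### Rounds of a copy and their numbering. -/

section Counting

variable {P : Type*} [DecidableEq P] {c : ℕ → P} {p : P}

theorem card_sameContext_lt {h h' : ℕ} (hlt : h < h') (hc : c h = c h') :
    (sameContext c h).card < (sameContext c h').card := by
  refine Finset.card_lt_card ((Finset.ssubset_iff_of_subset fun s hs => ?_).2 ⟨h, ?_, ?_⟩)
  · simp only [sameContext, Finset.mem_filter, Finset.mem_range] at hs ⊢
    exact ⟨hs.1.trans hlt, hs.2.trans hc⟩
  · simp [sameContext, hlt, hc]
  · simp [sameContext]

theorem sameContext_eq_filter {h : ℕ} (hc : c h = p) :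
    sameContext c h = (Finset.range h).filter (fun s => c s = p) := by
  rw [sameContext, hc]

/-- Up to the horizon, the first `j` rounds with context `p` are those before the round that is
number `j + 1` among them. -/
theorem filter_card_lt_eq_sameContext {H h j : ℕ} (hh : h < H) (hc : c h = p)
    (hj : (sameContext c h).card = j) :
    (Finset.range H).filter
        (fun s => c s = p ∧ ((Finset.range s).filter (fun r => c r = p)).card < j) =
      sameContext c h := by
  ext s
  simp only [Finset.mem_filter, Finset.mem_range, sameContext_eq_filter hc]
  constructor
  · rintro ⟨-, hs, hlt⟩
    refine ⟨?_, hs⟩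
    rw [← sameContext_eq_filter hs] at hlt
    by_contra! hle
    rcases hle.eq_or_lt with rfl | hlt'
    · omega
    · have := card_sameContext_lt hlt' (hc.trans hs.symm)
      omega
  · rintro ⟨hlt, hs⟩
    refine ⟨hlt.trans hh, hs, ?_⟩
    rw [← sameContext_eq_filter hs, ← hj]
    exact card_sameContext_lt hlt (hs.trans hc.symm)

/-- Rounds with one context have distinct numbers. This trades the failed rounds, at random times,
for failed indices in a deterministic range. -/
theorem card_filter_sameContext_le (H : ℕ) (F : ℕ → Prop) [DecidablePred F] :
    (((Finset.range H).filter (fun h => c h = p)).filter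
      (fun h => F (sameContext c h).card)).card ≤ ((Finset.range H).filter F).card := by
  refine Finset.card_le_card_of_injOn (fun h => (sameContext c h).card) ?_ ?_
  · intro h hh
    simp only [Finset.coe_filter, Finset.mem_filter, Finset.mem_range, Set.mem_ofPred_eq] at hh ⊢
    refine ⟨lt_of_le_of_lt ?_ hh.1.1, hh.2⟩
    exact (Finset.card_filter_le _ _).trans (Finset.card_range h).le
  · intro h hh h' hh' heq
    simp only [Finset.coe_filter, Finset.mem_filter, Finset.mem_range,
      Set.mem_ofPred_eq] at hh hh' heq
    rcases lt_trichotomy h h' with hlt | rfl | hlt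
    · exact absurd heq (card_sameContext_lt hlt (hh.1.2.trans hh'.1.2.symm)).ne
    · rfl
    · exact absurd heq (card_sameContext_lt hlt (hh'.1.2.trans hh.1.2.symm)).ne'

/-- A zero arm changes neither the Gram matrix nor the noise sum, so masking arms is the same as
dropping rounds. -/
theorem logMixture_ite {b : ℕ} (lam : ℝ) (S : Finset ℕ) (Q : ℕ → Prop) [DecidablePred Q]
    (x : ℕ → EuclideanSpace ℝ (Fin b)) (e : ℕ → ℝ) :
    logMixture lam S (fun s => if Q s then x s else 0) e = logMixture lam (S.filter Q) x e := by
  have h1 : gram lam S (fun s => if Q s then x s else 0) = gram lam (S.filter Q) x := by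
    rw [gram, gram, Finset.sum_filter]
    congr 1
    refine Finset.sum_congr rfl fun s _ => ?_
    split_ifs
    · rfl
    · ext i j
      simp [Matrix.vecMulVec_apply]
  have h2 : ∑ s ∈ S, e s • (if Q s then x s else 0).ofLp =
      ∑ s ∈ S.filter Q, e s • (x s).ofLp := by
    rw [Finset.sum_filter]
    refine Finset.sum_congr rfl fun s _ => ?_
    split_ifs <;> simp
  rw [logMixture, logMixture, h1, h2]

end Counting

/-! ### Regret of one copy along a path. -/

section Regret

/-- Factor in the bound of the log-determinant by a multiple of `b * log (e + n)`. -/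
noncomputable def logDetConst (lam : ℝ) : ℝ := 1 + Real.log (1 + 1 / lam)

/-- Constant in the regret bound of one copy of LinUCB. -/
noncomputable def linUCBConst (lam q : ℝ) : ℝ :=
  2 * ((1 + √lam + √(2 * q + logDetConst lam)) * √(2 * logDetConst lam))

variable {b : ℕ} {lam q : ℝ}

theorem one_le_logDetConst (hlam : 0 < lam) : 1 ≤ logDetConst lam := by
  have : 0 ≤ Real.log (1 + 1 / lam) := Real.log_nonneg (by simp [hlam.le])
  rw [logDetConst]
  linarith

/-- The shift by `e` keeps the logarithm at least 1, so that additive constants can be absorbed into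
it. -/
theorem one_le_log_exp_add {r : ℝ} (hr : 0 ≤ r) : 1 ≤ Real.log (Real.exp 1 + r) := by
  rw [Real.le_log_iff_exp_le (by positivity)]
  linarith

theorem log_one_add_div_le (hlam : 0 < lam) {r : ℝ} (hr : 0 ≤ r) :
    Real.log (1 + r / lam) ≤ logDetConst lam * Real.log (Real.exp 1 + r) := by
  have h1 := one_le_log_exp_add hr
  have h2 : Real.log (1 + r) ≤ Real.log (Real.exp 1 + r) :=
    Real.log_le_log (by linarith) (by linarith [Real.one_le_exp zero_le_one])
  have h3 : Real.log (1 + r / lam) ≤ Real.log (1 + 1 / lam) + Real.log (1 + r) := by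
    rw [← Real.log_mul (by positivity) (by positivity)]
    refine Real.log_le_log (by positivity) ?_
    have : (1 + 1 / lam) * (1 + r) = 1 + r / lam + (r + 1 / lam) := by ring
    rw [this]
    exact le_add_of_nonneg_right (by positivity)
  have h4 : 0 ≤ Real.log (1 + 1 / lam) := Real.log_nonneg (by simp [hlam.le])
  rw [logDetConst]
  nlinarith

theorem log_det_gram_le_logDetConst (hlam : 0 < lam) {S : Finset ℕ}
    {x : ℕ → EuclideanSpace ℝ (Fin b)} (hx : ∀ s ∈ S, ‖x s‖ ≤ 1) {n : ℕ} (hn : S.card ≤ n) :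
    Real.log ((gram lam S x).det / lam ^ b) ≤
      logDetConst lam * (b * Real.log (Real.exp 1 + n)) := by
  refine (log_det_gram_le hlam S hx).trans ?_
  calc _ ≤ b * Real.log (1 + n / lam) := by gcongr
    _ ≤ b * (logDetConst lam * Real.log (Real.exp 1 + n)) := by
      gcongr
      exact log_one_add_div_le hlam (Nat.cast_nonneg n)
    _ = _ := by ring

/-- The confidence radius in the first `n` rounds of a copy. -/
theorem confRadius_le (hlam : 0 < lam) (hq : 0 ≤ q) (hb : 1 ≤ b) {S : Finset ℕ}
    {x : ℕ → EuclideanSpace ℝ (Fin b)} (hx : ∀ s ∈ S, ‖x s‖ ≤ 1) {n : ℕ} (hn : S.card + 1 ≤ n) :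
    1 + confRadius lam (1 / ((S.card + 1 : ℕ) : ℝ) ^ q) S x ≤
      (1 + √lam + √(2 * q + logDetConst lam)) * √(b * Real.log (Real.exp 1 + n)) := by
  have hK := one_le_logDetConst hlam
  have hL := one_le_log_exp_add (Nat.cast_nonneg (α := ℝ) n)
  have hb' : (1 : ℝ) ≤ b := by exact_mod_cast hb
  set L := Real.log (Real.exp 1 + n) with hLdef
  have hbL : 1 ≤ b * L := one_le_mul_of_one_le_of_one_le hb' hL
  have hlog : Real.log (1 / (1 / ((S.card + 1 : ℕ) : ℝ) ^ q)) ≤ q * (b * L) := by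
    rw [one_div_one_div, Real.log_rpow (by positivity)]
    refine mul_le_mul_of_nonneg_left ?_ hq
    have h1 : Real.log ((S.card + 1 : ℕ) : ℝ) ≤ L := by
      refine Real.log_le_log (by positivity) ?_
      have : ((S.card + 1 : ℕ) : ℝ) ≤ n := by exact_mod_cast hn
      linarith [Real.exp_pos 1]
    exact h1.trans (le_mul_of_one_le_left (by linarith) hb')
  have hdet := log_det_gram_le_logDetConst hlam hx (Nat.le_of_succ_le hn)
  have hR := confRadius_le_of_log_le (R := (2 * q + logDetConst lam) * (b * L))
    (le_of_le_of_eq (add_le_add (mul_le_mul_of_nonneg_left hlog zero_le_two) hdet) (by ring))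
  rw [Real.sqrt_mul (by linarith)] at hR
  have h2 : 1 ≤ √(b * L) := Real.one_le_sqrt.2 hbL
  nlinarith [mul_le_mul_of_nonneg_left h2 (by positivity : 0 ≤ 1 + √lam)]

/-- Introduces the truncation needed by the potential lemma: where `w ≥ 1` the trivial bound 2 is
used, paid for by the spare 1 in `1 + rad ≤ R`. -/
theorem le_mul_sqrt_min {g R w : ℝ} (hg2 : g ≤ 2) {rad : ℝ} (hrad : 1 + rad ≤ R)
    (hrad0 : 0 ≤ rad) (hg : g ≤ 2 * (rad * √w)) : g ≤ 2 * R * √(min 1 w) := by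
  rcases le_total 1 w with h | h
  · rw [min_eq_left h, Real.sqrt_one]
    linarith
  · rw [min_eq_right h]
    have : rad * √w ≤ R * √w := by gcongr; linarith
    linarith

/-- Regret of one copy of LinUCB along a path, given bounds on the instantaneous regret in the
rounds in which the confidence ellipsoid contains the reward parameter. The predicate `F j` holds if
that fails in the round number `j + 1` of the copy. -/
theorem sum_gap_le {P : Type*} [DecidableEq P] (hlam : 0 < lam) (hq : 0 ≤ q) (hb : 1 ≤ b) {H : ℕ}
    {c : ℕ → P} (p : P) {x : ℕ → EuclideanSpace ℝ (Fin b)} (hx : ∀ h < H, ‖x h‖ ≤ 1) {g : ℕ → ℝ}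
    (F : ℕ → Prop) [DecidablePred F] (hg2 : ∀ h < H, g h ≤ 2)
    (hg : ∀ h < H, c h = p → ¬ F (sameContext c h).card → g h ≤
      2 * (confRadius lam (1 / (((sameContext c h).card + 1 : ℕ) : ℝ) ^ q) (sameContext c h) x *
        √(dotProduct (x h).ofLp ((gram lam (sameContext c h) x)⁻¹.mulVec (x h).ofLp)))) :
    ∑ h ∈ (Finset.range H).filter (fun h => c h = p), g h ≤
      linUCBConst lam q * b * (√(((Finset.range H).filter (fun h => c h = p)).card : ℝ) *
        Real.log (Real.exp 1 + (((Finset.range H).filter (fun h => c h = p)).card : ℝ))) +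
      2 * ∑ j ∈ Finset.range H, if F j then (1 : ℝ) else 0 := by
  set Rp := (Finset.range H).filter (fun h => c h = p) with hRp
  set n := Rp.card with hn
  set L := Real.log (Real.exp 1 + (n : ℝ)) with hL
  have hL1 : 1 ≤ L := one_le_log_exp_add (Nat.cast_nonneg n)
  have hK := one_le_logDetConst hlam
  set D := 1 + √lam + √(2 * q + logDetConst lam) with hD
  have hmem : ∀ h ∈ Rp, h < H ∧ c h = p := fun h hh => by simpa [hRp] using hh
  set w : ℕ → ℝ := fun h => dotProduct (x h).ofLp
    ((gram lam ((Finset.range h).filter (fun s => c s = p)) x)⁻¹.mulVec (x h).ofLp) with hw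
  have hstep : ∀ h ∈ Rp, g h ≤ 2 * (D * √(b * L)) * √(min 1 (w h)) +
      2 * if F (sameContext c h).card then 1 else 0 := by
    intro h hh
    obtain ⟨hH, hc⟩ := hmem h hh
    split_ifs with hF
    · have : 0 ≤ 2 * (D * √(b * L)) * √(min 1 (w h)) := by positivity
      linarith [hg2 h hH]
    · have hcard : (sameContext c h).card + 1 ≤ n := by
        rw [sameContext_eq_filter hc, hn, ← Finset.card_insert_of_notMem (a := h) (by simp)]
        refine Finset.card_le_card fun s hs => ?_
        simp only [Finset.mem_insert, Finset.mem_filter, Finset.mem_range, hRp] at hs ⊢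
        rcases hs with rfl | hs
        · exact ⟨hH, hc⟩
        · exact ⟨hs.1.trans hH, hs.2⟩
      have hxS : ∀ s ∈ sameContext c h, ‖x s‖ ≤ 1 := fun s hs => by
        simp only [sameContext, Finset.mem_filter, Finset.mem_range] at hs
        exact hx s (hs.1.trans hH)
      have h1 := hg h hH hc hF
      have h2 := confRadius_le hlam hq hb hxS hcard
      rw [mul_zero, add_zero]
      refine le_mul_sqrt_min (hg2 h hH) h2 (by rw [confRadius]; positivity) ?_
      simp only [hw, ← sameContext_eq_filter hc]
      exact h1
  have hbad : ∑ h ∈ Rp, (if F (sameContext c h).card then (1 : ℝ) else 0) ≤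
      ∑ j ∈ Finset.range H, if F j then (1 : ℝ) else 0 := by
    rw [Finset.sum_boole, Finset.sum_boole]
    exact_mod_cast card_filter_sameContext_le H F
  -- Cauchy–Schwarz over the `n` rounds of the copy, then the elliptical potential lemma.
  have hpot : ∑ h ∈ Rp, √(min 1 (w h)) ≤ √n * √(2 * logDetConst lam * (b * L)) := by
    have hw0 : ∀ h, 0 ≤ min 1 (w h) := fun h =>
      le_min zero_le_one ((posDef_gram hlam _ x).inv.quad_nonneg _)
    have h1 : ∑ h ∈ Rp, min 1 (w h) ≤ 2 * logDetConst lam * (b * L) := by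
      refine (sum_min_one_quad_inv_gram_le hlam (fun s => c s = p) H).trans ?_
      rw [mul_assoc]
      exact mul_le_mul_of_nonneg_left (log_det_gram_le_logDetConst hlam
        (fun s hs => hx s (hmem s hs).1) le_rfl) zero_le_two
    rw [← Real.sqrt_mul (Nat.cast_nonneg n)]
    refine Real.le_sqrt_of_sq_le ((sq_sum_le_card_mul_sum_sq).trans ?_)
    rw [← hn]
    gcongr
    refine (Finset.sum_congr rfl fun h _ => Real.sq_sqrt (hw0 h)).le.trans h1
  calc ∑ h ∈ Rp, g h ≤ ∑ h ∈ Rp, (2 * (D * √(b * L)) * √(min 1 (w h)) +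
        2 * if F (sameContext c h).card then 1 else 0) := Finset.sum_le_sum hstep
    _ = 2 * (D * √(b * L)) * ∑ h ∈ Rp, √(min 1 (w h)) +
        2 * ∑ h ∈ Rp, (if F (sameContext c h).card then (1 : ℝ) else 0) := by
      rw [Finset.sum_add_distrib, ← Finset.mul_sum, ← Finset.mul_sum]
    _ ≤ 2 * (D * √(b * L)) * (√n * √(2 * logDetConst lam * (b * L))) +
        2 * ∑ j ∈ Finset.range H, (if F j then (1 : ℝ) else 0) := by gcongr
    _ = _ := by
      congr 1
      rw [Real.sqrt_mul (by linarith : 0 ≤ 2 * logDetConst lam), linUCBConst, ← hD]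
      have h1 : √(b * L) * √(b * L) = b * L := Real.mul_self_sqrt (by positivity)
      calc _ = 2 * (D * √(2 * logDetConst lam)) * √n * (√(b * L) * √(b * L)) := by ring
        _ = _ := by rw [h1]; ring

end Regret

/-! ### Distributing the rounds among the contexts. -/

section Concavity

theorem log_one_add_le_two_mul_sqrt {r : ℝ} (hr : 0 ≤ r) : Real.log (1 + r) ≤ 2 * √r := by
  have h1 : Real.log (1 + r) ≤ Real.log ((1 + √r) ^ 2) := by
    refine Real.log_le_log (by linarith) ?_
    nlinarith [Real.sq_sqrt hr, Real.sqrt_nonneg r]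
  rw [Real.log_pow] at h1
  have h2 := Real.log_le_sub_one_of_pos (by positivity : 0 < 1 + √r)
  push_cast at h1
  linarith

/-- Replaces Jensen's inequality: a majorant that is affine in `n`, and within a factor 5 of the
left side at `n = r`. It is used with `r` the mean number of rounds per context. -/
theorem sqrt_mul_log_le {r n : ℝ} (hr : 0 < r) (hn : 0 ≤ n) :
    √n * Real.log (Real.exp 1 + n) ≤
      √r * Real.log (Real.exp 1 + r) * (5 / 2 * (1 + n / r)) := by
  obtain ⟨m, hm, rfl⟩ : ∃ m, 0 ≤ m ∧ n = r * m := ⟨n / r, by positivity, by field_simp⟩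
  have hL := one_le_log_exp_add hr.le
  have h1 : Real.log (Real.exp 1 + r * m) ≤ Real.log (Real.exp 1 + r) + Real.log (1 + m) := by
    rw [← Real.log_mul (by positivity) (by positivity)]
    refine Real.log_le_log (by positivity) ?_
    nlinarith [mul_nonneg (Real.exp_pos 1).le hm]
  have h0 : 0 ≤ Real.log (1 + m) := Real.log_nonneg (by linarith)
  have h2 : Real.log (Real.exp 1 + r * m) ≤ Real.log (Real.exp 1 + r) * (1 + Real.log (1 + m)) := by
    nlinarith
  -- Here `√m log (1 + m) ≤ 2m` and `√m ≤ (1 + m) / 2`.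
  have h3 : √m * (1 + Real.log (1 + m)) ≤ 5 / 2 * (1 + m) := by
    have := mul_le_mul_of_nonneg_left (log_one_add_le_two_mul_sqrt hm) (Real.sqrt_nonneg m)
    nlinarith [Real.sq_sqrt hm, sq_nonneg (√m - 1)]
  rw [mul_div_cancel_left₀ _ hr.ne', Real.sqrt_mul hr.le]
  calc _ ≤ √r * √m * (Real.log (Real.exp 1 + r) * (1 + Real.log (1 + m))) := by gcongr
    _ = √r * Real.log (Real.exp 1 + r) * (√m * (1 + Real.log (1 + m))) := by ring
    _ ≤ _ := by gcongr

theorem log_exp_one_add_le {r : ℝ} (hr : 1 ≤ r) :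
    Real.log (Real.exp 1 + r) ≤ 3 * max 1 (Real.log r) := by
  have he : 2 ≤ Real.exp 1 := by linarith [Real.add_one_le_exp 1]
  have h1 : Real.log (Real.exp 1 + r) ≤ 2 + Real.log r := by
    have h2 : Real.log (Real.exp 1 + r) ≤ Real.log (Real.exp 2 * r) := by
      refine Real.log_le_log (by positivity) ?_
      have h3 : Real.exp 2 = Real.exp 1 * Real.exp 1 := by rw [← Real.exp_add]; norm_num
      have h4 : 2 * r ≤ Real.exp 1 * r := by gcongr
      have h5 : Real.exp 1 * 1 ≤ Real.exp 1 * r := by gcongr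
      have h6 : 2 * (Real.exp 1 * r) ≤ Real.exp 1 * (Real.exp 1 * r) := by gcongr
      rw [h3]
      linarith
    rwa [Real.log_mul (by positivity) (by positivity), Real.log_exp] at h2
  linarith [le_max_left 1 (Real.log r), le_max_right 1 (Real.log r)]

/-- `H` rounds split among at most `H` contexts. -/
theorem sum_sqrt_mul_log_le {P : Type*} [Fintype P] [Nonempty P] (n : P → ℕ) {H : ℕ}
    (hn : ∑ p, n p = H) (hH : Fintype.card P ≤ H) :
    ∑ p, √(n p : ℝ) * Real.log (Real.exp 1 + n p) ≤
      15 * (√((H : ℝ) * Fintype.card P) * max 1 (Real.log ((H : ℝ) / Fintype.card P))) := by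
  set N : ℝ := ((Fintype.card P : ℕ) : ℝ) with hN
  have hN0 : 0 < N := by rw [hN]; exact_mod_cast Fintype.card_pos
  have hH' : N ≤ H := by rw [hN]; exact_mod_cast hH
  have hH0 : (0 : ℝ) < H := hN0.trans_le hH'
  have hr1 : 1 ≤ (H : ℝ) / N := (one_le_div hN0).2 hH'
  set r : ℝ := (H : ℝ) / N with hr
  -- The ratios `n p / r` have mean 1, so only the total `H` matters and not the split.
  have hsum : ∑ p, (5 / 2 * (1 + (n p : ℝ) / r)) = 5 * N := by
    rw [← Finset.mul_sum, Finset.sum_add_distrib, ← Finset.sum_div, ← Nat.cast_sum, hn, hr]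
    simp only [Finset.sum_const, Finset.card_univ, nsmul_eq_mul, mul_one, ← hN]
    field_simp
    ring
  have hroot : √r * N = √((H : ℝ) * N) := by
    have : (H : ℝ) * N = r * N ^ 2 := by rw [hr]; field_simp
    rw [this, Real.sqrt_mul (by positivity), Real.sqrt_sq hN0.le]
  calc _ ≤ ∑ p, √r * Real.log (Real.exp 1 + r) * (5 / 2 * (1 + (n p : ℝ) / r)) :=
        Finset.sum_le_sum fun p _ => sqrt_mul_log_le (by positivity) (Nat.cast_nonneg _)
    _ = 5 * (√r * N) * Real.log (Real.exp 1 + r) := by rw [← Finset.mul_sum, hsum]; ring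
    _ ≤ 5 * (√r * N) * (3 * max 1 (Real.log r)) := by
      gcongr
      exact log_exp_one_add_le hr1
    _ = _ := by rw [hroot]; ring

end Concavity

/-! ### Probability that a confidence ellipsoid fails. -/

section Failure

variable {Ω : Type*} {b : ℕ} {lam q : ℝ}

/-- The arms pulled in the first `j` rounds with context `p`, and the zero vector in all other
rounds. -/
def firstArms {P : Type*} [DecidableEq P] (c : ℕ → P) (p : P) (j : ℕ)
    (x : ℕ → EuclideanSpace ℝ (Fin b)) (s : ℕ) : EuclideanSpace ℝ (Fin b) :=
  if c s = p ∧ ((Finset.range s).filter (fun r => c r = p)).card < j then x s else 0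

/-- In the round number `j + 1` with context `p`, if there is one before the horizon, the confidence
ellipsoid may fail to contain the reward parameter. -/
def ConfidenceFails {P : Type*} [DecidableEq P] (lam q : ℝ) (H : ℕ) (c : ℕ → P)
    (x : ℕ → EuclideanSpace ℝ (Fin b)) (e : ℕ → ℝ) (p : P) (j : ℕ) : Prop :=
  Real.log (1 / (1 / ((j + 1 : ℕ) : ℝ) ^ q)) <
    logMixture lam (Finset.range H) (firstArms c p j x) e

/-- At a random round `h`, the process of the copy equals a masked process at the fixed horizon,
indexed by the round's number. -/
theorem logMixture_firstArms {P : Type*} [DecidableEq P] {c : ℕ → P} {p : P} {H h : ℕ} (hh : h < H)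
    (hc : c h = p) (x : ℕ → EuclideanSpace ℝ (Fin b)) (e : ℕ → ℝ) :
    logMixture lam (Finset.range H) (firstArms c p (sameContext c h).card x) e =
      logMixture lam (sameContext c h) x e := by
  refine (logMixture_ite lam (Finset.range H) (fun s => c s = p ∧
    ((Finset.range s).filter (fun r => c r = p)).card < (sameContext c h).card) x e).trans ?_
  rw [filter_card_lt_eq_sameContext hh hc rfl]

variable {P : Type*} [DecidableEq P] [MeasurableSpace P] [MeasurableSingletonClass P]

/-- Whether round `h` is masked depends only on the contexts up to `h`, so masked arms remain
predictable. -/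
theorem measurable_firstArms {m : MeasurableSpace Ω} {c : ℕ → Ω → P} {h : ℕ}
    {x : ℕ → Ω → EuclideanSpace ℝ (Fin b)} (hc : ∀ s ≤ h, Measurable (c s))
    (hx : Measurable (x h)) (p : P) (j : ℕ) :
    Measurable fun ω => firstArms (fun s => c s ω) p j (fun s => x s ω) h := by
  have hset : ∀ s ≤ h, MeasurableSet {ω | c s ω = p} :=
    fun s hs => hc s hs (measurableSet_singleton p)
  refine Measurable.ite ((hset h le_rfl).inter ?_) hx measurable_const
  have hcard : Measurable fun ω => ((Finset.range h).filter (fun r => c r ω = p)).card := by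
    simp only [Finset.card_filter]
    refine Finset.measurable_sum _ fun s hs => ?_
    exact Measurable.ite (hset s (Finset.mem_range.1 hs).le) measurable_const measurable_const
  exact hcard (measurableSet_Iio (a := j))

variable [mΩ : MeasurableSpace Ω] {μ : Measure Ω}

theorem measureReal_log_lt_le {f : Ω → ℝ} {t : ℝ} (ht : 0 < t)
    (hf : ∫⁻ ω, ENNReal.ofReal (Real.exp (f ω)) ∂μ ≤ 1) (hfm : Measurable f) :
    μ.real {ω | Real.log t < f ω} ≤ 1 / t := by
  have h1 := (mul_meas_ge_le_lintegral (μ := μ) (Real.measurable_exp.comp hfm).ennreal_ofReal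
    (ENNReal.ofReal t)).trans hf
  have hsub : {ω | Real.log t < f ω} ⊆
      {ω | ENNReal.ofReal t ≤ ENNReal.ofReal ((Real.exp ∘ f) ω)} := fun ω hω =>
    ENNReal.ofReal_le_ofReal ((Real.log_le_iff_le_exp ht).1 (le_of_lt hω))
  have h2 : ENNReal.ofReal t * μ {ω | Real.log t < f ω} ≤ 1 :=
    (mul_le_mul_right (measure_mono hsub) _).trans h1
  have h3 := ENNReal.toReal_mono ENNReal.one_ne_top h2
  rw [ENNReal.toReal_mul, ENNReal.toReal_ofReal ht.le, ENNReal.toReal_one] at h3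
  rw [le_div_iff₀ ht, mul_comm]
  exact h3

variable {ℱ : Filtration ℕ mΩ} {H : ℕ} {c : ℕ → Ω → P} {x : ℕ → Ω → EuclideanSpace ℝ (Fin b)}
  {η : ℕ → Ω → ℝ}

theorem measurable_logMixture_firstArms (hc : ∀ h < H, Measurable[ℱ h] (c h))
    (hx : ∀ h < H, Measurable[ℱ h] (x h)) (hη : ∀ h < H, Measurable[ℱ (h + 1)] (η h))
    (p : P) (j : ℕ) : Measurable fun ω => logMixture lam (Finset.range H)
      (firstArms (fun s => c s ω) p j (fun s => x s ω)) (fun s => η s ω) := by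
  refine measurable_logMixture
    (x := fun s ω => firstArms (fun s => c s ω) p j (fun s => x s ω) s)
    (fun h hh => ?_) (fun h hh => (hη h (Finset.mem_range.1 hh)).mono (ℱ.le _) le_rfl)
  have hh' := Finset.mem_range.1 hh
  exact measurable_firstArms (fun s hs => (hc s (hs.trans_lt hh')).mono (ℱ.le _) le_rfl)
    ((hx h hh').mono (ℱ.le _) le_rfl) p j

theorem measureReal_confidenceFails_le [IsProbabilityMeasure μ] (hlam : 0 < lam)
    (hc : ∀ h < H, Measurable[ℱ h] (c h))
    (hx : ∀ h < H, Measurable[ℱ h] (x h)) (hη : ∀ h < H, Measurable[ℱ (h + 1)] (η h))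
    (hind : ∀ h < H, Indep (MeasurableSpace.comap (η h) inferInstance) (ℱ h) μ)
    (hsub : ∀ h < H, HasSubgaussianMGF (η h) 1 μ) (p : P) (j : ℕ) :
    μ.real {ω | ConfidenceFails lam q H (fun s => c s ω) (fun s => x s ω) (fun s => η s ω) p j} ≤
      1 / ((j + 1 : ℕ) : ℝ) ^ q := by
  have h := measureReal_log_lt_le (μ := μ) (t := 1 / (1 / ((j + 1 : ℕ) : ℝ) ^ q)) (by positivity)
    (lintegral_exp_logMixture_le
      (x := fun s ω => firstArms (fun s => c s ω) p j (fun s => x s ω) s) hlam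
      (fun h hh => measurable_firstArms
        (fun s hs => (hc s (hs.trans_lt hh)).mono (ℱ.mono hs) le_rfl) (hx h hh) p j)
      hη hind hsub) (measurable_logMixture_firstArms hc hx hη p j)
  rwa [one_div_one_div (1 / ((j + 1 : ℕ) : ℝ) ^ q)] at h

end Failure

/-! ### Expected regret over all contexts. -/

section ExpectedRegret

variable {Ω : Type*} {b : ℕ} {lam q : ℝ}
  {P : Type*} [Fintype P]

/-- Constant in the regret bound, depending only on the regularization and on the exponent of the
confidence schedule. -/
noncomputable def regretConst (lam q : ℝ) : ℝ :=
  15 * linUCBConst lam q + 2 * ∑' j : ℕ, 1 / ((j + 1 : ℕ) : ℝ) ^ q + 2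

theorem linUCBConst_nonneg (hlam : 0 < lam) : 0 ≤ linUCBConst lam q := by
  rw [linUCBConst]
  positivity

/-- The summand 2 of `regretConst` serves the case of fewer rounds than contexts. -/
theorem regretConst_ge_two (hlam : 0 < lam) : 2 ≤ regretConst lam q := by
  have h1 := linUCBConst_nonneg (q := q) hlam
  have h2 : 0 ≤ ∑' j : ℕ, 1 / ((j + 1 : ℕ) : ℝ) ^ q := tsum_nonneg fun j => by positivity
  rw [regretConst]
  linarith

theorem sum_one_div_rpow_le (hq : 1 < q) (H : ℕ) :
    ∑ j ∈ Finset.range H, 1 / ((j + 1 : ℕ) : ℝ) ^ q ≤ ∑' j : ℕ, 1 / ((j + 1 : ℕ) : ℝ) ^ q :=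
  ((summable_nat_add_iff 1).2 (Real.summable_one_div_nat_rpow.2 hq)).sum_le_tsum _
    fun j _ => by positivity

/-- Path of the sum of instantaneous regrets of LinUCB run separately on each context. -/
theorem sum_gap_le_of_isSeparateLinUCB [DecidableEq P] [Nonempty P] (hlam : 0 < lam)
    (hq : 0 ≤ q) (hb : 1 ≤ b)
    {ϑ : P → EuclideanSpace ℝ (Fin b)} (hϑ : ∀ p, ‖ϑ p‖ ≤ 1) {H : ℕ} (hH : Fintype.card P ≤ H)
    {c : ℕ → P} {A : ℕ → Finset (EuclideanSpace ℝ (Fin b))} (hne : ∀ h < H, (A h).Nonempty)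
    (hA : ∀ h < H, ∀ y ∈ A h, ‖y‖ ≤ 1) {x : ℕ → EuclideanSpace ℝ (Fin b)} {e : ℕ → ℝ}
    (hucb : IsSeparateLinUCB lam (fun k => 1 / (k : ℝ) ^ q) H c A x
      (fun h => inner ℝ (x h) (ϑ (c h)) + e h))
    [∀ p, DecidablePred (ConfidenceFails lam q H c x e p)] :
    ∑ h ∈ Finset.range H, ((⨆ y : A h, inner ℝ (y : EuclideanSpace ℝ (Fin b)) (ϑ (c h)))
        - inner ℝ (x h) (ϑ (c h))) ≤
      linUCBConst lam q * b * (15 * (√((H : ℝ) * Fintype.card P) *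
        max 1 (Real.log ((H : ℝ) / Fintype.card P)))) +
      2 * ∑ p, ∑ j ∈ Finset.range H,
        if ConfidenceFails lam q H c x e p j then (1 : ℝ) else 0 := by
  have hx : ∀ h < H, ‖x h‖ ≤ 1 := fun h hh => hA h hh _ (hucb h hh).1
  set g : ℕ → ℝ := fun h => (⨆ y : A h, inner ℝ (y : EuclideanSpace ℝ (Fin b)) (ϑ (c h)))
        - inner ℝ (x h) (ϑ (c h)) with hg
  have hcopy := fun p => sum_gap_le hlam hq hb p hx (g := g) (ConfidenceFails lam q H c x e p)
    (fun h hh => iSup_inner_sub_inner_le_two (hϑ _) (hne h hh) (hA h hh) (hx h hh))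
    (fun h hh hc hF => by
      rw [ConfidenceFails, not_lt, logMixture_firstArms hh hc] at hF
      refine iSup_inner_sub_inner_le hlam (hϑ _) (fun s hs => ?_) hF (hne h hh) (hucb h hh).2
      have : c s = c h := (Finset.mem_filter.1 hs).2
      simp only [this])
  have hcard : ∑ p, ((Finset.range H).filter (fun h => c h = p)).card = H := by
    rw [← Finset.card_eq_sum_card_fiberwise (fun h _ => Finset.mem_coe.2 (Finset.mem_univ (c h))),
      Finset.card_range]
  rw [← Finset.sum_fiberwise _ c]
  refine (Finset.sum_le_sum fun p _ => hcopy p).trans ?_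
  rw [Finset.sum_add_distrib, ← Finset.mul_sum, ← Finset.mul_sum]
  have h0 := linUCBConst_nonneg (q := q) hlam
  gcongr
  exact sum_sqrt_mul_log_le _ hcard hH

variable [MeasurableSpace P] [MeasurableSingletonClass P]

/-- The maximum exceeds `a` exactly when the decision set meets an open half-space, which is an
event by `hA` once the context is fixed. -/
theorem measurable_iSup_inner {m : MeasurableSpace Ω} {c : Ω → P} (hc : Measurable c)
    {A : Ω → Finset (EuclideanSpace ℝ (Fin b))}
    (hA : ∀ O : Set (EuclideanSpace ℝ (Fin b)), IsOpen O → MeasurableSet {ω | ∃ y ∈ A ω, y ∈ O})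
    (hne : ∀ ω, (A ω).Nonempty) (ϑ : P → EuclideanSpace ℝ (Fin b)) :
    Measurable fun ω => ⨆ y : A ω, inner ℝ (y : EuclideanSpace ℝ (Fin b)) (ϑ (c ω)) := by
  refine measurable_of_Ioi fun a => ?_
  have hset : (fun ω => ⨆ y : A ω, inner ℝ (y : EuclideanSpace ℝ (Fin b)) (ϑ (c ω))) ⁻¹' Set.Ioi a =
      ⋃ p : P, {ω | c ω = p} ∩ {ω | ∃ y ∈ A ω, y ∈ {y | a < inner ℝ y (ϑ p)}} := by
    ext ω
    have : Nonempty (A ω) := (hne ω).to_subtype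
    simp only [Set.mem_preimage, Set.mem_Ioi, Set.mem_iUnion, Set.mem_inter_iff,
      Set.mem_ofPred_eq, exists_eq_left']
    rw [lt_ciSup_iff (Set.finite_range _).bddAbove]
    simp
  rw [hset]
  refine MeasurableSet.iUnion fun p => (hc (measurableSet_singleton p)).inter (hA _ ?_)
  exact isOpen_lt continuous_const (by fun_prop)

variable [mΩ : MeasurableSpace Ω] {μ : Measure Ω} [IsProbabilityMeasure μ]
  {ℱ : Filtration ℕ mΩ} {H : ℕ} {c : ℕ → Ω → P} {A : ℕ → Ω → Finset (EuclideanSpace ℝ (Fin b))}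
  {x : ℕ → Ω → EuclideanSpace ℝ (Fin b)} {η : ℕ → Ω → ℝ} {ϑ : P → EuclideanSpace ℝ (Fin b)}

theorem integrable_iSup_inner_sub_inner (hϑ : ∀ p, ‖ϑ p‖ ≤ 1) {c : Ω → P}
    {A : Ω → Finset (EuclideanSpace ℝ (Fin b))} {x : Ω → EuclideanSpace ℝ (Fin b)}
    (hc : Measurable c) (hx : Measurable x)
    (hA : ∀ O : Set (EuclideanSpace ℝ (Fin b)), IsOpen O → MeasurableSet {ω | ∃ y ∈ A ω, y ∈ O})
    (hne : ∀ ω, (A ω).Nonempty) (hA1 : ∀ ω, ∀ y ∈ A ω, ‖y‖ ≤ 1) (hxA : ∀ ω, x ω ∈ A ω) :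
    Integrable (fun ω => (⨆ y : A ω, inner ℝ (y : EuclideanSpace ℝ (Fin b)) (ϑ (c ω)))
        - inner ℝ (x ω) (ϑ (c ω))) μ := by
  have hϑm : Measurable fun ω => ϑ (c ω) := (measurable_of_finite ϑ).comp hc
  refine Integrable.of_bound (C := 2)
    ((measurable_iSup_inner hc hA hne ϑ).sub (hx.inner hϑm)).aestronglyMeasurable
    (Filter.Eventually.of_forall fun ω => ?_)
  rw [Real.norm_of_nonneg (iSup_inner_sub_inner_nonneg (hxA ω))]
  exact iSup_inner_sub_inner_le_two (hϑ _) (hne ω) (hA1 ω) (hA1 ω _ (hxA ω))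

/-- Expected sum of instantaneous regrets of LinUCB run separately on each context. -/
theorem integral_sum_gap_le [DecidableEq P] (hlam : 0 < lam) (hq : 1 < q) (hϑ : ∀ p, ‖ϑ p‖ ≤ 1)
    (hc : ∀ h < H, Measurable[ℱ h] (c h))
    (hint : ∀ h < H, Integrable (fun ω =>
      (⨆ y : A h ω, inner ℝ (y : EuclideanSpace ℝ (Fin b)) (ϑ (c h ω)))
        - inner ℝ (x h ω) (ϑ (c h ω))) μ)
    (hne : ∀ h < H, ∀ ω, (A h ω).Nonempty) (hA1 : ∀ h < H, ∀ ω, ∀ y ∈ A h ω, ‖y‖ ≤ 1)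
    (hx : ∀ h < H, Measurable[ℱ h] (x h)) (hη : ∀ h < H, Measurable[ℱ (h + 1)] (η h))
    (hind : ∀ h < H, Indep (MeasurableSpace.comap (η h) inferInstance) (ℱ h) μ)
    (hsub : ∀ h < H, HasSubgaussianMGF (η h) 1 μ)
    (hucb : ∀ ω, IsSeparateLinUCB lam (fun k => 1 / (k : ℝ) ^ q) H (fun h => c h ω)
      (fun h => A h ω) (fun h => x h ω) (fun h => inner ℝ (x h ω) (ϑ (c h ω)) + η h ω)) :
    ∫ ω, ∑ h ∈ Finset.range H,
        ((⨆ y : A h ω, inner ℝ (y : EuclideanSpace ℝ (Fin b)) (ϑ (c h ω)))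
          - inner ℝ (x h ω) (ϑ (c h ω))) ∂μ ≤
      regretConst lam q * (b * √((H : ℝ) * Fintype.card P) *
        max 1 (Real.log ((H : ℝ) / Fintype.card P))) := by
  classical
  have hC := regretConst_ge_two (q := q) hlam
  have : Nonempty Ω := nonempty_of_isProbabilityMeasure μ
  have : Nonempty P := this.map (c 0)
  set N : ℝ := ((Fintype.card P : ℕ) : ℝ) with hN
  set M : ℝ := max 1 (Real.log ((H : ℝ) / N)) with hM
  have hM1 : 1 ≤ M := le_max_left _ _
  have hintS := integrable_finsetSum (Finset.range H) fun h hh => hint h (Finset.mem_range.1 hh)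
  -- For `b = 0` the bound is 0, and so are all rewards without noise.
  rcases Nat.eq_zero_or_pos b with rfl | hb
  · have h0 : ∀ y z : EuclideanSpace ℝ (Fin 0), inner ℝ y z = (0 : ℝ) := fun y z => by
      rw [Subsingleton.elim y 0, inner_zero_left]
    simp [h0]
  have hb' : (1 : ℝ) ≤ b := by exact_mod_cast hb
  rcases lt_or_ge H (Fintype.card P) with hH | hH
  · have h1 : ∫ ω, ∑ h ∈ Finset.range H,
        ((⨆ y : A h ω, inner ℝ (y : EuclideanSpace ℝ (Fin b)) (ϑ (c h ω)))
          - inner ℝ (x h ω) (ϑ (c h ω))) ∂μ ≤ ∫ _, (H : ℝ) * 2 ∂μ := by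
      refine integral_mono hintS (integrable_const _) fun ω => ?_
      have : ∀ h ∈ Finset.range H,
          ((⨆ y : A h ω, inner ℝ (y : EuclideanSpace ℝ (Fin b)) (ϑ (c h ω)))
            - inner ℝ (x h ω) (ϑ (c h ω))) ≤ 2 := fun h hh => by
        have hh' := Finset.mem_range.1 hh
        exact iSup_inner_sub_inner_le_two (hϑ _) (hne h hh' ω) (hA1 h hh' ω)
          (hA1 h hh' ω _ (hucb ω h hh').1)
      simpa using Finset.sum_le_sum this
    rw [integral_const, probReal_univ, one_smul] at h1
    have h2 : (H : ℝ) ≤ √((H : ℝ) * N) := by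
      refine Real.le_sqrt_of_sq_le ?_
      have : (H : ℝ) ≤ N := by rw [hN]; exact_mod_cast hH.le
      rw [pow_two]
      gcongr
    calc _ ≤ (H : ℝ) * 2 := h1
      _ ≤ √((H : ℝ) * N) * 2 := by gcongr
      _ = 2 * (1 * √((H : ℝ) * N) * 1) := by ring
      _ ≤ _ := by gcongr
  · let E : P → ℕ → Set Ω := fun p j =>
      {ω | ConfidenceFails lam q H (fun s => c s ω) (fun s => x s ω) (fun s => η s ω) p j}
    have hE : ∀ p j, MeasurableSet (E p j) := fun p j =>
      measurableSet_lt measurable_const (measurable_logMixture_firstArms hc hx hη p j)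
    have hEint : ∀ p j, Integrable ((E p j).indicator (1 : Ω → ℝ)) μ := fun p j =>
      (integrable_const 1).indicator (hE p j)
    set K := linUCBConst lam q * b * (15 * (√((H : ℝ) * N) * M)) with hK
    have hbad : Integrable (fun ω => ∑ p, ∑ j ∈ Finset.range H,
        (E p j).indicator (1 : Ω → ℝ) ω) μ :=
      integrable_finsetSum _ fun p _ => integrable_finsetSum _ fun j _ => hEint p j
    have hbadle : ∫ ω, ∑ p, ∑ j ∈ Finset.range H, (E p j).indicator (1 : Ω → ℝ) ω ∂μ ≤
        N * ∑' j : ℕ, 1 / ((j + 1 : ℕ) : ℝ) ^ q := by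
      rw [integral_finsetSum _ fun p _ => integrable_finsetSum _ fun j _ => hEint p j]
      have : ∀ p ∈ Finset.univ, ∫ ω, ∑ j ∈ Finset.range H, (E p j).indicator (1 : Ω → ℝ) ω ∂μ ≤
          ∑' j : ℕ, 1 / ((j + 1 : ℕ) : ℝ) ^ q := fun p _ => by
        rw [integral_finsetSum _ fun j _ => hEint p j]
        refine (Finset.sum_le_sum fun j _ => ?_).trans (sum_one_div_rpow_le hq H)
        rw [integral_indicator_one (hE p j)]
        exact measureReal_confidenceFails_le hlam hc hx hη hind hsub p j
      simpa using Finset.sum_le_sum this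
    have hpath : ∀ ω, ∑ h ∈ Finset.range H,
        ((⨆ y : A h ω, inner ℝ (y : EuclideanSpace ℝ (Fin b)) (ϑ (c h ω)))
          - inner ℝ (x h ω) (ϑ (c h ω))) ≤
        K + 2 * ∑ p, ∑ j ∈ Finset.range H, (E p j).indicator (1 : Ω → ℝ) ω := fun ω => by
      simp only [Set.indicator_apply, Pi.one_apply, E, Set.mem_ofPred_eq]
      exact sum_gap_le_of_isSeparateLinUCB hlam (by linarith) hb hϑ hH
        (fun h hh => hne h hh ω) (fun h hh => hA1 h hh ω) (hucb ω)
    have hmain := integral_mono hintS ((integrable_const K).add (hbad.const_mul 2)) hpath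
    rw [integral_add' (integrable_const K) (hbad.const_mul 2), integral_const, probReal_univ,
      one_smul, integral_const_mul] at hmain
    -- The failures cost a constant per context; `N ≤ H` makes this a lower-order term.
    have hNroot : N ≤ b * √((H : ℝ) * N) * M := by
      have h1 : N ≤ √((H : ℝ) * N) := by
        refine Real.le_sqrt_of_sq_le ?_
        have : N ≤ H := by rw [hN]; exact_mod_cast hH
        rw [pow_two]
        gcongr
      calc N ≤ 1 * √((H : ℝ) * N) * 1 := by simpa using h1
        _ ≤ _ := by gcongr
    set Z := ∑' j : ℕ, 1 / ((j + 1 : ℕ) : ℝ) ^ q with hZ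
    have hZ0 : 0 ≤ Z := tsum_nonneg fun j => by positivity
    have h2 : N * Z ≤ (b * √((H : ℝ) * N) * M) * Z := by gcongr
    have h3 : 0 ≤ b * √((H : ℝ) * N) * M := by positivity
    rw [regretConst, ← hZ]
    calc _ ≤ K + 2 * (N * Z) := hmain.trans (by gcongr)
      _ ≤ K + 2 * ((b * √((H : ℝ) * N) * M) * Z) + 2 * (b * √((H : ℝ) * N) * M) := by linarith
      _ = _ := by rw [hK]; ring

end ExpectedRegret

/-! ### The main theorem. -/

/-- The context classes partition the rounds. Splitting off the noise, which has mean zero, leaves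
bounded nonnegative gaps. -/
theorem pathRegret_eq_sum_gap_sub_noise {U T n b : ℕ} (B : Fin T → Matrix (Fin b) (Fin n) ℝ)
    (θ : Fin U → EuclideanSpace ℝ (Fin n)) (H : ℕ) (c : ℕ → Fin U × Fin T)
    (A : ℕ → Finset (EuclideanSpace ℝ (Fin b))) (x : ℕ → EuclideanSpace ℝ (Fin b)) (e : ℕ → ℝ) :
    pathRegret B θ H c A (fun h => reward B θ (c h) (x h) (e h)) =
      ∑ h ∈ Finset.range H,
        ((⨆ y : A h, inner ℝ (y : EuclideanSpace ℝ (Fin b)) (rewardParam B θ (c h).1 (c h).2))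
          - inner ℝ (x h) (rewardParam B θ (c h).1 (c h).2)) - ∑ h ∈ Finset.range H, e h := by
  have h1 : (∑ t : Fin T, ∑ u : Fin U, ∑ h ∈ (Finset.range H).filter (fun h => c h = (u, t)),
      ⨆ y : A h, inner ℝ (y : EuclideanSpace ℝ (Fin b)) (rewardParam B θ u t)) =
      ∑ h ∈ Finset.range H,
        ⨆ y : A h, inner ℝ (y : EuclideanSpace ℝ (Fin b)) (rewardParam B θ (c h).1 (c h).2) := by
    rw [← Finset.sum_fiberwise _ c, Fintype.sum_prod_type, Finset.sum_comm]
    refine Finset.sum_congr rfl fun u _ => Finset.sum_congr rfl fun t _ =>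
      Finset.sum_congr rfl fun h hh => ?_
    rw [(Finset.mem_filter.1 hh).2]
  rw [pathRegret, h1]
  simp only [reward, Finset.sum_add_distrib, Finset.sum_sub_distrib]
  ring

/-- Regret of LinUCB run separately on each of the `U * T` user-task contexts. The constant `C`
depends only on the regularization `lam` and the exponent `q` of the confidence schedule. The
sigma-algebra `ℱ h` holds everything that is known before the noise `η h` of round `h` is drawn. -/
theorem mainTheorem5 (lam q : ℝ) (hlam : 0 < lam) (hq : 1 < q) :
    ∃ C : ℝ, 0 < C ∧
      ∀ (U T n b H : ℕ)
        -- task matrices and personal data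
        (B : Fin T → Matrix (Fin b) (Fin n) ℝ) (θ : Fin U → EuclideanSpace ℝ (Fin n))
        (_ : ∀ u t, ‖rewardParam B θ u t‖ ≤ 1)
        (Ω : Type*) [mΩ : MeasurableSpace Ω] (μ : Measure Ω) [IsProbabilityMeasure μ]
        (ℱ : Filtration ℕ mΩ)
        -- contexts, decision sets, pulled arms and noise
        (c : ℕ → Ω → Fin U × Fin T) (A : ℕ → Ω → Finset (EuclideanSpace ℝ (Fin b)))
        (x : ℕ → Ω → EuclideanSpace ℝ (Fin b)) (η : ℕ → Ω → ℝ)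
        (_ : ∀ h < H, Measurable[ℱ h] (c h))
        (_ : ∀ h < H, ∀ O : Set (EuclideanSpace ℝ (Fin b)), IsOpen O →
          MeasurableSet[ℱ h] {ω | ∃ y ∈ A h ω, y ∈ O})
        (_ : ∀ h < H, ∀ ω, (A h ω).Nonempty)
        (_ : ∀ h < H, ∀ ω, ∀ y ∈ A h ω, ‖y‖ ≤ 1)
        (_ : ∀ h < H, Measurable[ℱ h] (x h))
        -- independent (centred) 1-subgaussian noise
        (_ : ∀ h < H, Measurable[ℱ (h + 1)] (η h))
        (_ : ∀ h < H, Indep (MeasurableSpace.comap (η h) inferInstance) (ℱ h) μ)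
        (_ : ∀ h < H, HasSubgaussianMGF (η h) 1 μ)
        -- the agent runs LinUCB separately on each user-task pair
        (_ : ∀ ω, IsSeparateLinUCB lam (fun k => 1 / (k : ℝ) ^ q) H (fun h => c h ω)
          (fun h => A h ω) (fun h => x h ω) (fun h => reward B θ (c h ω) (x h ω) (η h ω))),
        Integrable (fun ω => pathRegret B θ H (fun h => c h ω) (fun h => A h ω)
            (fun h => reward B θ (c h ω) (x h ω) (η h ω))) μ ∧
          ∫ ω, pathRegret B θ H (fun h => c h ω) (fun h => A h ω)
              (fun h => reward B θ (c h ω) (x h ω) (η h ω)) ∂μ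
            ≤ C * ((b : ℝ) * √((H : ℝ) * T * U)
                * max 1 (Real.log ((H : ℝ) / ((T : ℝ) * U)))) := by
  refine ⟨regretConst lam q, two_pos.trans_le (regretConst_ge_two hlam), ?_⟩
  intro U T n b H B θ hϑ Ω mΩ μ _ ℱ c A x η hc hA hne hA1 hx hη hind hsub hucb
  let ϑ : Fin U × Fin T → EuclideanSpace ℝ (Fin b) := fun p => rewardParam B θ p.1 p.2
  have hgap : ∀ h < H, Integrable (fun ω =>
      (⨆ y : A h ω, inner ℝ (y : EuclideanSpace ℝ (Fin b)) (ϑ (c h ω)))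
        - inner ℝ (x h ω) (ϑ (c h ω))) μ := fun h hh =>
    integrable_iSup_inner_sub_inner (ϑ := ϑ) (c := c h) (A := A h) (x := x h)
      (fun p => hϑ p.1 p.2) ((hc h hh).mono (ℱ.le h) le_rfl) ((hx h hh).mono (ℱ.le h) le_rfl)
      (fun O hO => ℱ.le h _ (hA h hh O hO)) (hne h hh) (hA1 h hh) fun ω => (hucb ω h hh).1
  have hgaps := integrable_finsetSum (Finset.range H) fun h hh => hgap h (Finset.mem_range.1 hh)
  have hnoise : ∀ h ∈ Finset.range H, Integrable (η h) μ := fun h hh =>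
    (hsub h (Finset.mem_range.1 hh)).integrable
  have hnoises := integrable_finsetSum (Finset.range H) hnoise
  simp only [pathRegret_eq_sum_gap_sub_noise]
  refine ⟨hgaps.sub hnoises, ?_⟩
  have hzero : ∫ ω, ∑ h ∈ Finset.range H, η h ω ∂μ = 0 := by
    rw [integral_finsetSum _ hnoise]
    exact Finset.sum_eq_zero fun h hh =>
      integral_eq_zero_of_hasSubgaussianMGF (hsub h (Finset.mem_range.1 hh))
  have hmain := integral_sum_gap_le (ϑ := ϑ) hlam hq (fun p => hϑ p.1 p.2) hc hgap hne hA1 hx hη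
    hind hsub hucb
  have hcard : ((Fintype.card (Fin U × Fin T) : ℕ) : ℝ) = (T : ℝ) * U := by
    simp [mul_comm]
  rw [hcard, ← mul_assoc (H : ℝ)] at hmain
  rw [integral_sub hgaps hnoises, hzero, sub_zero]
  exact hmain
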